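/- Let $S$ be a monoid that has only finitely many left ideals and only finitely many right ideals. If $S$ has finite derivation type, then every Schützenberger group of $S$ has finite derivation type. Here the terms have the following meaning. *Schützenberger groups.* For $a,b\in S$ write $a\,\mathscr R\,b$ if $aS=bS$, $a\,\mathscr L\,b$ if $Sa=Sb$, and $\mathscr H=\mathscr R\cap\mathscr L$. For an $\mathscr H$-class $H$ let $\mathrm{Stab}(H)=\{s\in S: Hs=H\}$, and let $\sigma$ be the congruence on $\mathrm{Stab}(H)$ given by $(x,y)\in\sigma$ if and only if $hx=hy$ for all $h\in H$. The Schützenberger group of $H$ is $\mathrm{Stab}(H)/\sigma$, which is a group. *Squier complex.* Let $\langle A\mid\mathfrak R\rangle$ be a monoid presentation, $\mathfrak R\subseteq A^*\times A^*$, and write $r=(r_{+1},r_{-1})$ for $r\in\mathfrak R$. Its derivation graph has vertex set $A^*$ and edges $E=(\alpha,r,\epsilon,\beta)$ with $\alpha,\beta\in A^*$, $r\in\mathfrak R$, $\epsilon=\pm1$, with initial vertex $\iota E=\alpha r_\epsilon\beta$, terminal vertex $\tau E=\alpha r_{-\epsilon}\beta$ and inverse $E^{-1}=(\alpha,r,-\epsilon,\beta)$.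 Words act on edges by $\gamma\cdot E\cdot\delta=(\gamma\alpha,r,\epsilon,\beta\delta)$, and hence on paths. For a set $X$ of closed paths let $\mathcal D^X$ be the $2$-complex with this graph as $1$-skeleton whose defining closed paths are $$(E_1\cdot\iota E_2)\circ(\tau E_1\cdot E_2)\circ(E_1^{-1}\cdot\tau E_2)\circ(\iota E_1\cdot E_2^{-1})$$ for all edges $E_1,E_2$, together with $\gamma\cdot P\cdot\delta$ for all $P\in X$ and $\gamma,\delta\in A^*$. Two paths are homotopic in $\mathcal D^X$ if one is obtained from the other by finitely many moves that either insert or delete a subpath $E\circ E^{-1}$, or replace a subpath $p$ by a path $q$ such that $p\circ q^{-1}$ is a cyclic permutation of a defining path or of the inverse of one. The set $X$ is a homotopy base if every closed path is homotopic in $\mathcal D^X$ to an empty path. *Finite derivation type.* A monoid has finite derivation type if it is defined by some presentation $\langle A\mid\mathfrak R\rangle$ with $A$ and $\mathfrak R$ finite that has a finite homotopy base. -/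

import Mathlib

/-! ### Squier complexes and finite derivation type -/

namespace Squier

variable {A : Type*}

/-- The words `r₊₁` (for `true`) and `r₋₁` (for `false`) of a rule `r = (r₊₁, r₋₁)`. -/
def side (r : FreeMonoid A × FreeMonoid A) : Bool → FreeMonoid A
  | true => r.1
  | false => r.2

/-- The edges `(α, r, ε, β)` of the derivation graph of the presentation `⟨A | R⟩`;
the vertices are the words over `A`. The sign `ε = +1` is `true` and `ε = -1` is `false`. -/
@[ext]
structure Edge (R : Set (FreeMonoid A × FreeMonoid A)) where
  left : FreeMonoid A
  rule : R
  sign : Bool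
  right : FreeMonoid A

variable {R : Set (FreeMonoid A × FreeMonoid A)}

namespace Edge

/-- The initial vertex `α r_ε β`. -/
def src (e : Edge R) : FreeMonoid A := e.left * side e.rule.1 e.sign * e.right

/-- The terminal vertex `α r_{-ε} β`. -/
def tgt (e : Edge R) : FreeMonoid A := e.left * side e.rule.1 (!e.sign) * e.right

/-- The inverse edge `(α, r, -ε, β)`. -/
def inv (e : Edge R) : Edge R := ⟨e.left, e.rule, !e.sign, e.right⟩

/-- The two-sided action `γ · e · δ` of words on edges. -/
def act (γ : FreeMonoid A) (e : Edge R) (δ : FreeMonoid A) : Edge R :=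
  ⟨γ * e.left, e.rule, e.sign, e.right * δ⟩

end Edge

/-- `IsPath u p v`: the sequence of edges `p` is a path from the vertex `u` to the vertex `v`.
The empty sequence is the empty path at each vertex. -/
def IsPath : FreeMonoid A → List (Edge R) → FreeMonoid A → Prop
  | u, [], v => u = v
  | u, e :: p, v => e.src = u ∧ IsPath e.tgt p v

/-- The inverse path. -/
def pathInv (p : List (Edge R)) : List (Edge R) := (p.map Edge.inv).reverse

/-- The two-sided action `γ · p · δ` of words on paths. -/
def pathAct (γ : FreeMonoid A) (p : List (Edge R)) (δ : FreeMonoid A) : List (Edge R) :=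
  p.map fun e => e.act γ δ

/-- The elementary homotopy moves, on edge sequences, for a set `C` of defining paths
(deletions `e ∘ e⁻¹` are the reverses of insertions). -/
inductive Move (C : Set (List (Edge R))) : List (Edge R) → List (Edge R) → Prop
  | insert (a b : List (Edge R)) (e : Edge R) : Move C (a ++ b) (a ++ [e, e.inv] ++ b)
  | replace (a b p q c : List (Edge R)) (hc : c ∈ C)
      (h : (p ++ pathInv q).IsRotated c ∨ (p ++ pathInv q).IsRotated (pathInv c)) :
      Move C (a ++ p ++ b) (a ++ q ++ b)

/-- Homotopy of paths from `u` to `v` in the `2`-complex with the derivation graph of `⟨A | R⟩`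
as its `1`-skeleton and with defining paths `C`. All intermediate sequences are
paths from `u` to `v`. -/
def Homotopic (C : Set (List (Edge R))) (u v : FreeMonoid A) : List (Edge R) → List (Edge R) → Prop :=
  Relation.EqvGen fun p q => IsPath u p v ∧ IsPath u q v ∧ Move C p q

/-- The closed path `[e₁, e₂] = (e₁·ιe₂) ∘ (τe₁·e₂) ∘ (e₁⁻¹·τe₂) ∘ (ιe₁·e₂⁻¹)`. -/
def disjointCircuit (e₁ e₂ : Edge R) : List (Edge R) :=
  [e₁.act 1 e₂.src, e₂.act e₁.tgt 1, e₁.inv.act 1 e₂.tgt, e₂.inv.act e₁.src 1]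

/-- The defining paths of the complex `D^X`, where `D` is the Squier complex of `⟨A | R⟩`:
those of `D`, and the translates of the paths in `X`. -/
def definingPaths (X : Set (List (Edge R))) : Set (List (Edge R)) :=
  {c | ∃ e₁ e₂ : Edge R, c = disjointCircuit e₁ e₂} ∪
    {c | ∃ γ δ : FreeMonoid A, ∃ p ∈ X, c = pathAct γ p δ}

/-- A set `X` of closed paths is a homotopy base if all closed paths in `D^X` are
null-homotopic. -/
def IsHomotopyBase (X : Set (List (Edge R))) : Prop :=
  (∀ p ∈ X, ∃ w, IsPath w p w) ∧
    ∀ (w : FreeMonoid A) (p : List (Edge R)), IsPath w p w →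
      Homotopic (definingPaths X) w w p []

end Squier

/-- The presentation `⟨A | R⟩` has finite derivation type: its Squier complex admits a finite
homotopy base. -/
def PresentationFDT {A : Type*} (R : Set (FreeMonoid A × FreeMonoid A)) : Prop :=
  ∃ X : Set (List (Squier.Edge R)), X.Finite ∧ Squier.IsHomotopyBase X

/-- The monoid `M` has finite derivation type: it is defined by some finite presentation that has
finite derivation type. -/
def MonoidFDT (M : Type*) [Monoid M] : Prop :=
  ∃ (A : Type) (R : Set (FreeMonoid A × FreeMonoid A)), Finite A ∧ R.Finite ∧
    Nonempty (PresentedMonoid (fun u v => (u, v) ∈ R) ≃* M) ∧ PresentationFDT R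

/-! ### Green's relations and Schützenberger groups -/

section Green

variable {S : Type*} [Monoid S]

/-- Green's relation `R`: each of `a`, `b` lies in the principal right ideal of the other. -/
def GreenR (a b : S) : Prop := (∃ x, a = b * x) ∧ ∃ y, b = a * y

/-- Green's relation `L`: each of `a`, `b` lies in the principal left ideal of the other. -/
def GreenL (a b : S) : Prop := (∃ x, a = x * b) ∧ ∃ y, b = y * a

/-- Green's relation `H`, the intersection of `R` and `L`. -/
def GreenH (a b : S) : Prop := GreenR a b ∧ GreenL a b

/-- `H` is an equivalence class of Green's relation `H`. -/
def IsHClass (H : Set S) : Prop := ∃ h : S, H = {x | GreenH x h}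

/-- The right stabilizer `Stab(H) = {s | H s = H}`. -/
def rightStab (H : Set S) : Submonoid S where
  carrier := {s | (fun h => h * s) '' H = H}
  one_mem' := by simp
  mul_mem' := by
    intro a b ha hb
    have ha' : (fun h => h * a) '' H = H := ha
    have hb' : (fun h => h * b) '' H = H := hb
    have : (fun h => h * (a * b)) '' H = (fun h => h * b) '' ((fun h => h * a) '' H) := by
      simp [Set.image_image, mul_assoc]
    exact this.trans (by rw [ha', hb'])

/-- The congruence `σ(H)` on the right stabilizer: `x σ y` if `h x = h y` for all `h ∈ H`. -/
def schutzenbergerCon (H : Set S) : Con (rightStab H) where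
  r x y := ∀ h ∈ H, h * (x : S) = h * (y : S)
  iseqv := ⟨fun _ _ _ => rfl, fun hxy h hh => (hxy h hh).symm,
    fun hxy hyz h hh => (hxy h hh).trans (hyz h hh)⟩
  mul' := by
    intro w x y z hwx hyz h hh
    have hw : h * (w : S) ∈ H := by
      have hs : (fun h => h * (w : S)) '' H = H := w.2
      exact hs.subset ⟨h, hh, rfl⟩
    simp only [Submonoid.coe_mul, ← mul_assoc]
    rw [hyz _ hw, hwx h hh]

/-- The right Schützenberger group `Stab(H) / σ(H)`. -/
abbrev SchutzenbergerGroup (H : Set S) : Type _ := (schutzenbergerCon H).Quotient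

/-- For an `H`-class `H`, the monoid `Stab(H) / σ(H)` is a group. -/
theorem SchutzenbergerGroup.isUnit {H : Set S} (hH : IsHClass H) (g : SchutzenbergerGroup H) :
    IsUnit g := by
  obtain ⟨h₀, hH⟩ := hH
  have h₀H : h₀ ∈ H := by
    rw [hH]
    exact ⟨⟨⟨1, by simp⟩, ⟨1, by simp⟩⟩, ⟨⟨1, by simp⟩, ⟨1, by simp⟩⟩⟩
  induction g using Con.induction_on with
  | H s =>
    have hs : (fun h => h * (s : S)) '' H = H := s.2
    have hmem : h₀ * (s : S) ∈ H := hs.subset ⟨h₀, h₀H, rfl⟩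
    have hmem' : GreenH (h₀ * (s : S)) h₀ := hH.subset hmem
    obtain ⟨⟨-, t, ht⟩, -⟩ := hmem'
    have hst : ∀ h ∈ H, h * (s : S) * t = h := by
      intro h hh
      have hh' : GreenH h h₀ := hH.subset hh
      obtain ⟨-, ⟨x, rfl⟩, -⟩ := hh'
      rw [mul_assoc x, mul_assoc x, ← ht]
    have htH : t ∈ rightStab H := by
      change (fun h => h * t) '' H = H
      conv_lhs => rw [← hs, Set.image_image]
      ext y
      constructor
      · rintro ⟨h, hh, rfl⟩
        simpa [hst h hh] using hh
      · intro hy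
        exact ⟨y, hy, hst y hy⟩
    rw [isUnit_iff_exists]
    refine ⟨((⟨t, htH⟩ : rightStab H) : (schutzenbergerCon H).Quotient), ?_, ?_⟩
    · refine (Con.eq (schutzenbergerCon H)).2 fun h hh => ?_
      simpa [← mul_assoc] using hst h hh
    · refine (Con.eq (schutzenbergerCon H)).2 fun h hh => ?_
      obtain ⟨k, hk, rfl⟩ := hs.superset hh
      simp [← mul_assoc, hst k hk]

end Green

/-! Write G for the Schützenberger group of the H-class of h. If q h lies in that class then q h = h
x with x in the right stabilizer, so G is also the quotient of the left stabilizer by "equal action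
on h" (`exists_leftStab_hom`).

S acts from the left on its finitely many R-classes. For an R-class T and an L-class ℓ, choose where
possible a multiplier p carrying the representative t of T into the R-class of h and into ℓ. Reading
a word w that ends over T, from state ℓ, gives p w t = q p' t with p' another chosen multiplier and
q in the left stabilizer. This is a rewriting of Reidemeister–Schreier type: a word over A has as
output a word in letters (T, a, ℓ), of value q in G. Outputs are multiplicative up to a shift of
object and state (`out_mul`), hence carry edges, disjoint circuits and translates to the same kind
of object, and parallel paths over A have homotopic outputs (`htp_outPath_base`).

Fix a word w₀ leading from the R-class of 1 to that of h, with output of value 1; it represents an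
element of the H-class of h itself. A word β over the new letters has a word `loops β` over A of the
same value, and in S the product `loops β * w₀` equals `w₀ * z` with z depending only on the value
of β. So β is joined to a normal form by appending the output of w₀, passing to the output of `loops
β * w₀`, and following an output path to the output of `w₀ * z`.

These paths contract the complex once they are compatible with every edge
(`isHomotopyBase_of_contraction`). A left context of a relation is moved away by exchange. A right
context β is absorbed because `loops β * w₀` can be replaced by `w₀ * z`, so only circuits with w₀
over the finitely many R-classes are needed (`compat_loops_mul_w₀`). -/

namespace Squier

/-! ### Edges, paths and their translates -/

variable {A : Type*} {R : Set (FreeMonoid A × FreeMonoid A)}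

namespace Edge

@[simp] theorem src_inv (e : Edge R) : e.inv.src = e.tgt := rfl

@[simp] theorem tgt_inv (e : Edge R) : e.inv.tgt = e.src := by
  simp [inv, src, tgt]

@[simp] theorem inv_inv (e : Edge R) : e.inv.inv = e := by
  simp [inv]

@[simp] theorem src_act (γ δ : FreeMonoid A) (e : Edge R) : (e.act γ δ).src = γ * e.src * δ := by
  simp [act, src, mul_assoc]

@[simp] theorem tgt_act (γ δ : FreeMonoid A) (e : Edge R) : (e.act γ δ).tgt = γ * e.tgt * δ := by
  simp [act, tgt, mul_assoc]

theorem act_inv (γ δ : FreeMonoid A) (e : Edge R) : (e.act γ δ).inv = e.inv.act γ δ := rfl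

@[simp] theorem act_act (γ δ γ' δ' : FreeMonoid A) (e : Edge R) :
    (e.act γ δ).act γ' δ' = e.act (γ' * γ) (δ * δ') := by
  simp [act, mul_assoc]

@[simp] theorem act_one_one (e : Edge R) : e.act 1 1 = e := by
  simp [act]

end Edge

theorem pathInv_append (p q : List (Edge R)) : pathInv (p ++ q) = pathInv q ++ pathInv p := by
  simp [pathInv]

@[simp] theorem pathInv_nil : pathInv ([] : List (Edge R)) = [] := rfl

@[simp] theorem pathInv_singleton (e : Edge R) : pathInv [e] = [e.inv] := rfl

@[simp] theorem pathInv_pathInv (p : List (Edge R)) : pathInv (pathInv p) = p := by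
  simp [pathInv, Function.comp_def]

@[simp] theorem pathAct_nil (γ δ : FreeMonoid A) : pathAct γ ([] : List (Edge R)) δ = [] := rfl

@[simp] theorem pathAct_cons (γ δ : FreeMonoid A) (e : Edge R) (p : List (Edge R)) :
    pathAct γ (e :: p) δ = e.act γ δ :: pathAct γ p δ := rfl

@[simp] theorem pathAct_append (γ δ : FreeMonoid A) (p q : List (Edge R)) :
    pathAct γ (p ++ q) δ = pathAct γ p δ ++ pathAct γ q δ := by
  simp [pathAct]

@[simp] theorem pathAct_one_one (p : List (Edge R)) : pathAct 1 p 1 = p := by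
  simp [pathAct]

@[simp] theorem pathAct_pathAct (γ δ γ' δ' : FreeMonoid A) (p : List (Edge R)) :
    pathAct γ' (pathAct γ p δ) δ' = pathAct (γ' * γ) p (δ * δ') := by
  simp [pathAct]

theorem pathInv_pathAct (γ δ : FreeMonoid A) (p : List (Edge R)) :
    pathInv (pathAct γ p δ) = pathAct γ (pathInv p) δ := by
  simp [pathAct, pathInv, Edge.act_inv]

@[simp] theorem isPath_nil {u v : FreeMonoid A} : IsPath u ([] : List (Edge R)) v ↔ u = v := Iff.rfl

@[simp] theorem isPath_cons {u v : FreeMonoid A} {e : Edge R} {p : List (Edge R)} :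
    IsPath u (e :: p) v ↔ e.src = u ∧ IsPath e.tgt p v := Iff.rfl

theorem isPath_append {u w : FreeMonoid A} {p q : List (Edge R)} :
    IsPath u (p ++ q) w ↔ ∃ v, IsPath u p v ∧ IsPath v q w := by
  induction p generalizing u with
  | nil => simp
  | cons e p ih => simp [ih, and_assoc]

namespace IsPath

variable {u v w : FreeMonoid A} {p q : List (Edge R)}

theorem append (hp : IsPath u p v) (hq : IsPath v q w) : IsPath u (p ++ q) w :=
  isPath_append.2 ⟨v, hp, hq⟩

theorem inv (hp : IsPath u p v) : IsPath v (pathInv p) u := by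
  induction p generalizing u with
  | nil => exact hp.symm
  | cons e p ih =>
    rw [← List.singleton_append, pathInv_append]
    refine (ih hp.2).append ?_
    simpa using hp.1

theorem act (γ δ : FreeMonoid A) (hp : IsPath u p v) :
    IsPath (γ * u * δ) (pathAct γ p δ) (γ * v * δ) := by
  induction p generalizing u with
  | nil => simpa using congrArg (fun x => γ * x * δ) hp
  | cons e p ih => exact ⟨by rw [Edge.src_act, hp.1], by rw [Edge.tgt_act]; exact ih hp.2⟩

theorem act_left (γ : FreeMonoid A) (hp : IsPath u p v) :
    IsPath (γ * u) (pathAct γ p 1) (γ * v) := by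
  simpa using hp.act γ 1

theorem act_right (δ : FreeMonoid A) (hp : IsPath u p v) :
    IsPath (u * δ) (pathAct 1 p δ) (v * δ) := by
  simpa using hp.act 1 δ

end IsPath

/-- `p` and `q` are homotopic paths from `u` to `v` in `D^X`. -/
structure Htp (X : Set (List (Edge R))) (u v : FreeMonoid A) (p q : List (Edge R)) : Prop where
  left : IsPath u p v
  right : IsPath u q v
  homotopic : Homotopic (definingPaths X) u v p q

theorem Move.congr {C : Set (List (Edge R))} {p q : List (Edge R)} (h : Move C p q)
    (a b : List (Edge R)) : Move C (a ++ p ++ b) (a ++ q ++ b) := by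
  cases h with
  | insert c d e => simpa using Move.insert (C := C) (a ++ c) (d ++ b) e
  | replace c d p q x hc h => simpa using Move.replace (C := C) (a ++ c) (d ++ b) p q x hc h

theorem pathAct_disjointCircuit (γ δ : FreeMonoid A) (e₁ e₂ : Edge R) :
    pathAct γ (disjointCircuit e₁ e₂) δ = disjointCircuit (e₁.act γ 1) (e₂.act 1 δ) := by
  simp [disjointCircuit, Edge.act_inv]

theorem pathAct_mem_definingPaths {X : Set (List (Edge R))} {c : List (Edge R)}
    (hc : c ∈ definingPaths X) (γ δ : FreeMonoid A) : pathAct γ c δ ∈ definingPaths X := by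
  rcases hc with ⟨e₁, e₂, rfl⟩ | ⟨γ', δ', p, hp, rfl⟩
  · exact Or.inl ⟨_, _, pathAct_disjointCircuit γ δ e₁ e₂⟩
  · exact Or.inr ⟨_, _, p, hp, pathAct_pathAct ..⟩

theorem Move.act {X : Set (List (Edge R))} {p q : List (Edge R)} (h : Move (definingPaths X) p q)
    (γ δ : FreeMonoid A) : Move (definingPaths X) (pathAct γ p δ) (pathAct γ q δ) := by
  cases h with
  | insert a b e =>
    simpa [Edge.act_inv] using Move.insert (C := definingPaths X) (pathAct γ a δ) (pathAct γ b δ)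
      (e.act γ δ)
  | replace a b p q c hc h =>
    simp only [pathAct_append]
    refine Move.replace _ _ _ _ (pathAct γ c δ) (pathAct_mem_definingPaths hc γ δ) ?_
    rw [pathInv_pathAct, pathInv_pathAct, ← pathAct_append]
    exact h.imp (fun h => h.map _) (fun h => h.map _)

/-! ### Calculus of homotopies -/

namespace Htp

variable {X : Set (List (Edge R))} {u v w : FreeMonoid A} {p q r s : List (Edge R)}

theorem refl (hp : IsPath u p v) : Htp X u v p p := ⟨hp, hp, .refl _⟩

theorem symm (h : Htp X u v p q) : Htp X u v q p := ⟨h.right, h.left, .symm _ _ h.homotopic⟩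

theorem trans (h : Htp X u v p q) (h' : Htp X u v q r) : Htp X u v p r :=
  ⟨h.left, h'.right, .trans _ _ _ h.homotopic h'.homotopic⟩

theorem of_move (hp : IsPath u p v) (hq : IsPath u q v) (h : Move (definingPaths X) p q) :
    Htp X u v p q := ⟨hp, hq, .rel _ _ ⟨hp, hq, h⟩⟩

theorem congr {u' v' : FreeMonoid A} {a b : List (Edge R)} (ha : IsPath u' a u)
    (h : Htp X u v p q) (hb : IsPath v b v') : Htp X u' v' (a ++ p ++ b) (a ++ q ++ b) := by
  obtain ⟨hp, hq, h⟩ := h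
  refine ⟨(ha.append hp).append hb, (ha.append hq).append hb, ?_⟩
  clear hp hq
  induction h with
  | rel x y h =>
    exact .rel _ _ ⟨(ha.append h.1).append hb, (ha.append h.2.1).append hb, h.2.2.congr a b⟩
  | refl => exact .refl _
  | symm x y _ ih => exact .symm _ _ ih
  | trans x y z _ _ ih₁ ih₂ => exact .trans _ _ _ ih₁ ih₂

theorem append (h : Htp X u v p q) (h' : Htp X v w r s) : Htp X u w (p ++ r) (q ++ s) := by
  have h₁ := congr (a := []) rfl h h'.left
  have h₂ := congr (b := []) h.right h' rfl
  simp only [List.nil_append, List.append_nil] at h₁ h₂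
  exact h₁.trans h₂

theorem append_left {a : List (Edge R)} (ha : IsPath w a u) (h : Htp X u v p q) :
    Htp X w v (a ++ p) (a ++ q) :=
  (refl ha).append h

theorem append_right {b : List (Edge R)} (h : Htp X u v p q) (hb : IsPath v b w) :
    Htp X u w (p ++ b) (q ++ b) :=
  h.append (refl hb)

theorem act (γ δ : FreeMonoid A) (h : Htp X u v p q) :
    Htp X (γ * u * δ) (γ * v * δ) (pathAct γ p δ) (pathAct γ q δ) := by
  obtain ⟨hp, hq, h⟩ := h
  refine ⟨hp.act γ δ, hq.act γ δ, ?_⟩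
  clear hp hq
  induction h with
  | rel x y h => exact .rel _ _ ⟨h.1.act γ δ, h.2.1.act γ δ, h.2.2.act γ δ⟩
  | refl => exact .refl _
  | symm x y _ ih => exact .symm _ _ ih
  | trans x y z _ _ ih₁ ih₂ => exact .trans _ _ _ ih₁ ih₂

theorem act_left (γ : FreeMonoid A) (h : Htp X u v p q) :
    Htp X (γ * u) (γ * v) (pathAct γ p 1) (pathAct γ q 1) := by
  simpa using h.act γ 1

theorem act_right (δ : FreeMonoid A) (h : Htp X u v p q) :
    Htp X (u * δ) (v * δ) (pathAct 1 p δ) (pathAct 1 q δ) := by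
  simpa using h.act 1 δ

theorem append_pathInv (hp : IsPath u p v) : Htp X u u (p ++ pathInv p) [] := by
  induction p generalizing u with
  | nil => exact refl rfl
  | cons e p ih =>
    obtain ⟨rfl, hp⟩ := hp
    have h₁ : Htp X e.src e.src ([e] ++ (p ++ pathInv p) ++ [e.inv]) ([e] ++ [] ++ [e.inv]) :=
      congr ⟨rfl, rfl⟩ (ih hp) (by simp)
    have h₂ : Htp X e.src e.src [] ([] ++ [e, e.inv] ++ []) :=
      of_move rfl (by simp) (Move.insert [] [] e)
    have h₃ := h₁.trans h₂.symm
    rw [← List.singleton_append, pathInv_append]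
    simpa using h₃

theorem pathInv_append_self (hp : IsPath u p v) : Htp X v v (pathInv p ++ p) [] := by
  simpa using append_pathInv (X := X) hp.inv

theorem cancel_left (hp : IsPath w p u) (hr : IsPath u r v) (hs : IsPath u s v)
    (h : Htp X w v (p ++ r) (p ++ s)) : Htp X u v r s := by
  have key : ∀ t, IsPath u t v → Htp X u v (pathInv p ++ (p ++ t)) t := fun t ht => by
    simpa using (pathInv_append_self (X := X) hp).append_right ht
  exact (key r hr).symm.trans ((h.append_left hp.inv).trans (key s hs))

/-- A path may be moved across a homotopy. -/
theorem eq_append_pathInv (hr : IsPath v r w) (h : Htp X u w (p ++ r) q) (hp : IsPath u p v) :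
    Htp X u v p (q ++ pathInv r) := by
  have h₁ : Htp X u v (p ++ (r ++ pathInv r)) (p ++ []) := (append_pathInv hr).append_left hp
  have h₂ := h.append_right hr.inv
  simp only [List.append_nil, List.append_assoc] at h₁ h₂
  exact h₁.symm.trans h₂

theorem of_mem {c : List (Edge R)} (hc : c ∈ definingPaths X) (hw : IsPath w c w) :
    Htp X w w c [] := by
  have := Move.replace [] [] c [] c hc (Or.inl (by simpa using List.IsRotated.refl _))
  exact of_move hw rfl (by simpa using this)

theorem exchange_edge (e₁ e₂ : Edge R) :
    Htp X (e₁.src * e₂.src) (e₁.tgt * e₂.tgt) [e₁.act 1 e₂.src, e₂.act e₁.tgt 1]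
      [e₂.act e₁.src 1, e₁.act 1 e₂.tgt] := by
  have := Move.replace [] [] [e₁.act 1 e₂.src, e₂.act e₁.tgt 1]
      [e₂.act e₁.src 1, e₁.act 1 e₂.tgt] (disjointCircuit e₁ e₂) (C := definingPaths X)
      (Or.inl ⟨_, _, rfl⟩) (Or.inl (by
        simpa [disjointCircuit, pathInv, Edge.act_inv] using List.IsRotated.refl _))
  exact of_move (by simp) (by simp) (by simpa using this)

theorem exchange_edge_path (e : Edge R) (hq : IsPath u q v) :
    Htp X (e.src * u) (e.tgt * v) ([e.act 1 u] ++ pathAct e.tgt q 1)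
      (pathAct e.src q 1 ++ [e.act 1 v]) := by
  induction q generalizing u with
  | nil =>
    obtain rfl : u = v := hq
    exact refl (by simp)
  | cons f q ih =>
    obtain ⟨rfl, hq⟩ := hq
    have h₁ := (exchange_edge (X := X) e f).append_right (hq.act_left e.tgt)
    have h₂ := (ih hq).append_left (a := [f.act e.src 1]) (w := e.src * f.src) (by simp)
    simpa using h₁.trans h₂

/-- The two paths bound a grid whose cells, one for each edge of `p` and edge of `q`, are disjoint
circuits. -/
theorem exchange {u' v' : FreeMonoid A} (hp : IsPath u p u') (hq : IsPath v q v') :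
    Htp X (u * v) (u' * v') (pathAct 1 p v ++ pathAct u' q 1)
      (pathAct u q 1 ++ pathAct 1 p v') := by
  induction p generalizing u with
  | nil =>
    obtain rfl : u = u' := hp
    simpa using refl (hq.act_left u)
  | cons e p ih =>
    obtain ⟨rfl, hp⟩ := hp
    have h₁ := (ih hp).append_left (a := [e.act 1 v]) (w := e.src * v) (by simp)
    have h₂ := (exchange_edge_path (X := X) e hq).append_right (hp.act_right v')
    simpa using h₁.trans (by simpa using h₂)

end Htp

theorem htp_of_isHomotopyBase {X : Set (List (Edge R))} (hX : IsHomotopyBase X)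
    {u v : FreeMonoid A} {p q : List (Edge R)} (hp : IsPath u p v) (hq : IsPath u q v) :
    Htp X u v p q := by
  have h : Htp X u u (p ++ pathInv q) [] :=
    ⟨hp.append hq.inv, rfl, hX.2 _ _ (hp.append hq.inv)⟩
  simpa using Htp.eq_append_pathInv hq.inv h hp

/-- A family of paths with common endpoints that is compatible with all edges exhibits a homotopy
base. -/
theorem isHomotopyBase_of_contraction {X : Set (List (Edge R))} (hX : ∀ p ∈ X, ∃ w, IsPath w p w)
    (nf : FreeMonoid A → FreeMonoid A) (c : FreeMonoid A → List (Edge R))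
    (hc : ∀ u, IsPath u (c u) (nf u)) (hnf : ∀ e : Edge R, nf e.src = nf e.tgt)
    (hcomp : ∀ e : Edge R, Htp X e.src (nf e.src) ([e] ++ c e.tgt) (c e.src)) :
    IsHomotopyBase X := by
  refine ⟨hX, fun w p hp => ?_⟩
  -- The triangles telescope along a path. For a closed path this gives p ∘ c(w) ≃ c(w), and c(w)
  -- cancels.
  have key : ∀ (p : List (Edge R)) (u v), IsPath u p v →
      nf u = nf v ∧ Htp X u (nf u) (p ++ c v) (c u) := by
    intro p
    induction p with
    | nil =>
      intro u v h
      obtain rfl : u = v := h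
      exact ⟨rfl, .refl (hc u)⟩
    | cons e p ih =>
      rintro u v ⟨rfl, h⟩
      obtain ⟨h₁, h₂⟩ := ih _ _ h
      refine ⟨(hnf e).trans h₁, ?_⟩
      have h₃ := h₂.append_left (a := [e]) (w := e.src) (by simp)
      rw [← hnf e] at h₃
      simpa using h₃.trans (hcomp e)
  have h := (key p w w hp).2
  have h' := Htp.eq_append_pathInv (hc w) h hp
  exact (h'.trans (Htp.append_pathInv (hc w))).homotopic

theorem mk_eq_mk_iff_exists_isPath {u v : FreeMonoid A} :
    PresentedMonoid.mk (fun x y => (x, y) ∈ R) u = PresentedMonoid.mk (fun x y => (x, y) ∈ R) v ↔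
      ∃ p : List (Edge R), IsPath u p v := by
  constructor
  · rw [PresentedMonoid.mk_eq_mk_iff]
    intro h
    change ConGen.Rel _ u v at h
    induction h with
    | of x y h => exact ⟨[⟨1, ⟨(x, y), h⟩, true, 1⟩], by simp [Edge.src, Edge.tgt, side]⟩
    | refl x => exact ⟨[], rfl⟩
    | symm _ ih =>
      obtain ⟨p, hp⟩ := ih
      exact ⟨_, hp.inv⟩
    | trans _ _ ih₁ ih₂ =>
      obtain ⟨p, hp⟩ := ih₁
      obtain ⟨q, hq⟩ := ih₂
      exact ⟨_, hp.append hq⟩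
    | mul _ _ ih₁ ih₂ =>
      obtain ⟨p, hp⟩ := ih₁
      obtain ⟨q, hq⟩ := ih₂
      exact ⟨_, (hp.act_right _).append (hq.act_left _)⟩
  · rintro ⟨p, hp⟩
    induction p generalizing u with
    | nil => exact congrArg _ hp
    | cons e p ih =>
      obtain ⟨rfl, hp⟩ := hp
      rw [← ih hp]
      have h : PresentedMonoid.mk (fun x y => (x, y) ∈ R) e.rule.1.1 =
          PresentedMonoid.mk (fun x y => (x, y) ∈ R) e.rule.1.2 :=
        PresentedMonoid.mk_eq_mk_of_rel e.rule.2
      cases hs : e.sign <;> simp [Edge.src, Edge.tgt, hs, side, h]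

end Squier

/-! ### Rewriting words by transitions -/

namespace Squier

/-- A monoid `S` generated by `A`, acting on `Q` from the left, together with a transition function
on `Λ`. A transition along `s` starts over `s • T` and ends over `T`; the transition along `1` is
only required to be idempotent. -/
structure TransitionData (A S Q Λ : Type*) [Monoid S] where
  ev : FreeMonoid A →* S
  act : S → Q → Q
  act_one : ∀ T, act 1 T = T
  act_mul : ∀ s t T, act (s * t) T = act s (act t T)
  next : Q → S → Λ → Λ
  next_mul : ∀ T s t ℓ, next T (s * t) ℓ = next T t (next (act t T) s ℓ)

namespace TransitionData

variable {A S Q Λ : Type*} [Monoid S] (D : TransitionData A S Q Λ)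

/-- The output of the transition from `ℓ` along a word ending over `T`: a letter records the
object, the letter read, and the normalised state. -/
def outList : Q → Λ → List A → FreeMonoid (Q × A × Λ)
  | _, _, [] => 1
  | T, ℓ, a :: w =>
    FreeMonoid.of (D.act (D.ev (.ofList w)) T, a, D.next (D.act (D.ev (.ofList (a :: w))) T) 1 ℓ) *
      outList T (D.next (D.act (D.ev (.ofList w)) T) (D.ev (.of a)) ℓ) w

/-- `TransitionData.outList` on the free monoid. -/
def out (T : Q) (ℓ : Λ) (w : FreeMonoid A) : FreeMonoid (Q × A × Λ) := D.outList T ℓ w.toList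

@[simp] theorem out_one (T : Q) (ℓ : Λ) : D.out T ℓ 1 = 1 := rfl

theorem out_of_mul (T : Q) (ℓ : Λ) (a : A) (w : FreeMonoid A) :
    D.out T ℓ (.of a * w) =
      .of (D.act (D.ev w) T, a, D.next (D.act (D.ev (.of a * w)) T) 1 ℓ) *
        D.out T (D.next (D.act (D.ev w) T) (D.ev (.of a)) ℓ) w := rfl

@[simp] theorem next_next_one (T : Q) (s : S) (ℓ : Λ) :
    D.next T s (D.next (D.act s T) 1 ℓ) = D.next T s ℓ := by
  rw [← D.next_mul, one_mul]

@[simp] theorem next_one_next (T : Q) (s : S) (ℓ : Λ) :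
    D.next T 1 (D.next T s ℓ) = D.next T s ℓ := by
  have := D.next_mul T s 1 ℓ
  rw [mul_one, D.act_one] at this
  exact this.symm

/-- The first letter records only the normalised state, and every later state factors through it.
This is the case of an empty left factor in `out_mul`. -/
theorem out_normalize (T : Q) (ℓ : Λ) (w : FreeMonoid A) :
    D.out T (D.next (D.act (D.ev w) T) 1 ℓ) w = D.out T ℓ w := by
  induction w using FreeMonoid.casesOn with
  | one => rfl
  | of_mul a w =>
    rw [out_of_mul, out_of_mul, next_one_next]
    congr 2
    rw [map_mul, D.act_mul, next_next_one]

/-- The crossed multiplicativity from which the functoriality of outputs on edges and paths follows.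
-/
theorem out_mul (T : Q) (ℓ : Λ) (u v : FreeMonoid A) :
    D.out T ℓ (u * v) =
      D.out (D.act (D.ev v) T) ℓ u * D.out T (D.next (D.act (D.ev v) T) (D.ev u) ℓ) v := by
  induction u using FreeMonoid.inductionOn' generalizing ℓ with
  | one => rw [one_mul, out_one, one_mul, map_one, out_normalize]
  | of_mul a u ih =>
    rw [mul_assoc, out_of_mul, ih, out_of_mul]
    simp only [map_mul, D.act_mul, mul_assoc, D.next_mul]

variable {R : Set (FreeMonoid A × FreeMonoid A)}
  {R' : Set (FreeMonoid (Q × A × Λ) × FreeMonoid (Q × A × Λ))}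

/-- The relations of `R` hold in `S`. -/
def Respects (R : Set (FreeMonoid A × FreeMonoid A)) : Prop := ∀ r ∈ R, D.ev r.1 = D.ev r.2

/-- The outputs of both sides of each relation in `R`, along any transition, are related by `R'`. -/
def OutRelated (R : Set (FreeMonoid A × FreeMonoid A))
    (R' : Set (FreeMonoid (Q × A × Λ) × FreeMonoid (Q × A × Λ))) : Prop :=
  ∀ r ∈ R, ∀ T ℓ, (D.out T ℓ r.1, D.out T ℓ r.2) ∈ R'

theorem ev_side (hR : D.Respects R) (r : R) (ε : Bool) : D.ev (side r.1 ε) = D.ev r.1.1 := by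
  cases ε
  · exact (hR _ r.2).symm
  · rfl

variable {D}

theorem Respects.ev_tgt (hR : D.Respects R) (e : Edge R) : D.ev e.tgt = D.ev e.src := by
  simp [Edge.src, Edge.tgt, D.ev_side hR]

theorem Respects.ev_eq (hR : D.Respects R) {u v : FreeMonoid A} {p : List (Edge R)}
    (hp : IsPath u p v) : D.ev u = D.ev v := by
  induction p generalizing u with
  | nil => exact congrArg _ hp
  | cons e p ih =>
    obtain ⟨rfl, hp⟩ := hp
    rw [← hR.ev_tgt, ih hp]

/-- The image of an edge under the transition from `ℓ` ending over `T`. -/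
def outEdge (h : D.OutRelated R R') (T : Q) (ℓ : Λ) (e : Edge R) : Edge R' where
  -- Objects and states are computed from the first side of the rule for either sign. Both sides
  -- give the same result once the relations hold in `S`, and inversion becomes definitional.
  left := D.out (D.act (D.ev (e.rule.1.1 * e.right)) T) ℓ e.left
  rule := ⟨_, h e.rule.1 e.rule.2 (D.act (D.ev e.right) T)
    (D.next (D.act (D.ev (e.rule.1.1 * e.right)) T) (D.ev e.left) ℓ)⟩
  sign := e.sign
  right := D.out T (D.next (D.act (D.ev e.right) T) (D.ev (e.left * e.rule.1.1)) ℓ) e.right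

variable (h : D.OutRelated R R')

theorem outEdge_inv (T : Q) (ℓ : Λ) (e : Edge R) :
    outEdge h T ℓ e.inv = (outEdge h T ℓ e).inv := rfl

theorem side_outEdge (T : Q) (ℓ : Λ) (e : Edge R) (ε : Bool) :
    side (outEdge h T ℓ e).rule.1 ε = D.out (D.act (D.ev e.right) T)
      (D.next (D.act (D.ev (e.rule.1.1 * e.right)) T) (D.ev e.left) ℓ) (side e.rule.1 ε) := by
  cases ε <;> rfl

theorem outEdge_aux (hR : D.Respects R) (T : Q) (ℓ : Λ) (e : Edge R) (ε : Bool) :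
    (outEdge h T ℓ e).left * side (outEdge h T ℓ e).rule.1 ε * (outEdge h T ℓ e).right =
      D.out T ℓ (e.left * side e.rule.1 ε * e.right) := by
  rw [side_outEdge, out_mul, out_mul, map_mul, ev_side D hR]
  simp only [outEdge, map_mul, D.act_mul, D.ev_side hR]

theorem src_outEdge (hR : D.Respects R) (T : Q) (ℓ : Λ) (e : Edge R) :
    (outEdge h T ℓ e).src = D.out T ℓ e.src := outEdge_aux h hR T ℓ e _

theorem tgt_outEdge (hR : D.Respects R) (T : Q) (ℓ : Λ) (e : Edge R) :
    (outEdge h T ℓ e).tgt = D.out T ℓ e.tgt := outEdge_aux h hR T ℓ e _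

theorem outEdge_act (hR : D.Respects R) (T : Q) (ℓ : Λ) (γ δ : FreeMonoid A) (e : Edge R) :
    outEdge h T ℓ (e.act γ δ) =
      (outEdge h (D.act (D.ev δ) T) (D.next (D.act (D.ev (e.src * δ)) T) (D.ev γ) ℓ) e).act
        (D.out (D.act (D.ev (e.src * δ)) T) ℓ γ)
        (D.out T (D.next (D.act (D.ev δ) T) (D.ev (γ * e.src)) ℓ) δ) := by
  have hs : D.ev e.src = D.ev e.left * D.ev e.rule.1.1 * D.ev e.right := by
    simp [Edge.src, D.ev_side hR]
  ext1
  · simp only [outEdge, Edge.act, D.out_mul, map_mul, hs, D.act_mul]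
  · simp only [outEdge, Edge.act, map_mul, hs, D.act_mul, D.next_mul]
  · rfl
  · simp only [outEdge, Edge.act, D.out_mul, map_mul, hs, D.act_mul, D.next_mul]

/-- The image of a path under the transition from `ℓ` ending over `T`. -/
def outPath (T : Q) (ℓ : Λ) (p : List (Edge R)) : List (Edge R') := p.map (outEdge h T ℓ)

@[simp] theorem outPath_append (T : Q) (ℓ : Λ) (p q : List (Edge R)) :
    outPath h T ℓ (p ++ q) = outPath h T ℓ p ++ outPath h T ℓ q := List.map_append

theorem outPath_pathInv (T : Q) (ℓ : Λ) (p : List (Edge R)) :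
    outPath h T ℓ (pathInv p) = pathInv (outPath h T ℓ p) := by
  simp [outPath, pathInv, outEdge_inv]

theorem isPath_outPath (hR : D.Respects R) (T : Q) (ℓ : Λ) {u v : FreeMonoid A}
    {p : List (Edge R)} (hp : IsPath u p v) :
    IsPath (D.out T ℓ u) (outPath h T ℓ p) (D.out T ℓ v) := by
  induction p generalizing u with
  | nil => exact congrArg _ hp
  | cons e p ih =>
    obtain ⟨rfl, hp⟩ := hp
    exact ⟨src_outEdge h hR T ℓ e, by rw [tgt_outEdge h hR]; exact ih hp⟩

/-- The infinitely many translates of `p` are sent to translates of the outputs of `p` itself, one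
for each object and state; with finitely many of these, a finite base has finitely many outputs up
to translation. -/
theorem outPath_pathAct (hR : D.Respects R) (T : Q) (ℓ : Λ) (γ δ : FreeMonoid A)
    {u v : FreeMonoid A} {p : List (Edge R)} (hp : IsPath u p v) :
    outPath h T ℓ (pathAct γ p δ) =
      pathAct (D.out (D.act (D.ev (u * δ)) T) ℓ γ)
        (outPath h (D.act (D.ev δ) T) (D.next (D.act (D.ev (u * δ)) T) (D.ev γ) ℓ) p)
        (D.out T (D.next (D.act (D.ev δ) T) (D.ev (γ * u)) ℓ) δ) := by
  induction p generalizing u with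
  | nil => rfl
  | cons e p ih =>
    obtain ⟨rfl, hp⟩ := hp
    have := ih hp
    simp only [map_mul, hR.ev_tgt] at this
    simp only [pathAct_cons, outPath, List.map_cons] at this ⊢
    rw [this, outEdge_act h hR]
    simp only [map_mul]

theorem outPath_disjointCircuit (hR : D.Respects R) (T : Q) (ℓ : Λ) (e₁ e₂ : Edge R) :
    outPath h T ℓ (disjointCircuit e₁ e₂) =
      disjointCircuit (outEdge h (D.act (D.ev e₂.src) T) ℓ e₁)
        (outEdge h T (D.next (D.act (D.ev e₂.src) T) (D.ev e₁.src) ℓ) e₂) := by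
  -- Translating by empty words normalises the state, so an edge does not see the difference.
  have hn : ∀ (T : Q) (e : Edge R),
      outEdge h T (D.next (D.act (D.ev e.src) T) 1 ℓ) e = outEdge h T ℓ e := by
    intro T e
    have := outEdge_act h hR T ℓ 1 1 e
    simpa [D.act_one] using this.symm
  have h₁ := hR.ev_tgt e₁
  have h₂ := hR.ev_tgt e₂
  simp only [disjointCircuit, outPath, List.map_cons, List.map_nil, outEdge_act h hR, out_one,
    map_one, mul_one, one_mul, D.act_one, src_outEdge h hR, tgt_outEdge h hR, Edge.src_inv,
    outEdge_inv, h₁, h₂, map_mul, D.act_mul, hn]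

/-- Homotopies are mapped to homotopies. -/
theorem htp_outPath (hR : D.Respects R) {X : Set (List (Edge R))} {X' : Set (List (Edge R'))}
    (hX : ∀ p ∈ X, ∃ w, IsPath w p w) (hX' : ∀ p ∈ X, ∀ T ℓ, outPath h T ℓ p ∈ X')
    (T : Q) (ℓ : Λ) {u v : FreeMonoid A} {p q : List (Edge R)} (hpq : Htp X u v p q) :
    Htp X' (D.out T ℓ u) (D.out T ℓ v) (outPath h T ℓ p) (outPath h T ℓ q) := by
  obtain ⟨hp, hq, H⟩ := hpq
  refine ⟨isPath_outPath h hR T ℓ hp, isPath_outPath h hR T ℓ hq, ?_⟩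
  clear hp hq
  induction H with
  | rel x y H =>
    refine .rel _ _ ⟨isPath_outPath h hR T ℓ H.1, isPath_outPath h hR T ℓ H.2.1, ?_⟩
    obtain ⟨-, -, H⟩ := H
    cases H with
    | insert a b e =>
      simpa [outPath, outEdge_inv] using Move.insert (C := definingPaths X')
        (outPath h T ℓ a) (outPath h T ℓ b) (outEdge h T ℓ e)
    | replace a b p q c hc H =>
      simp only [outPath_append]
      refine Move.replace _ _ _ _ (outPath h T ℓ c) ?_ ?_
      · rcases hc with ⟨e₁, e₂, rfl⟩ | ⟨γ, δ, p, hp, rfl⟩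
        · exact Or.inl ⟨_, _, outPath_disjointCircuit h hR T ℓ e₁ e₂⟩
        · obtain ⟨w, hw⟩ := hX p hp
          exact Or.inr ⟨_, _, _, hX' p hp _ _, outPath_pathAct h hR T ℓ γ δ hw⟩
      · rw [← outPath_pathInv, ← outPath_pathInv, ← outPath_append]
        exact H.imp (fun H => H.map _) (fun H => H.map _)
  | refl => exact .refl _
  | symm x y _ ih => exact .symm _ _ ih
  | trans x y z _ _ ih₁ ih₂ => exact .trans _ _ _ ih₁ ih₂

end TransitionData

end Squier

/-! ### The presentation of the target monoid -/

namespace Squier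

/-- Transition data whose outputs present the monoid `G`. The object `T₀` and the state `ℓ₀` support
loops realising all elements of `G`, and `w₀` leads from `T₀` to `T₁`. -/
structure Presenting {A S Q Λ : Type*} [Monoid S] (D : TransitionData A S Q Λ) (G : Type*)
    [Monoid G] where
  val : FreeMonoid (Q × A × Λ) →* G
  val_surjective : Function.Surjective val
  val_out : ∀ T ℓ u v, D.ev u = D.ev v → val (D.out T ℓ u) = val (D.out T ℓ v)
  T₀ : Q
  T₁ : Q
  ℓ₀ : Λ
  next_one : D.next T₀ 1 ℓ₀ = ℓ₀
  w₀ : FreeMonoid A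
  act_w₀ : D.act (D.ev w₀) T₁ = T₀
  val_w₀ : val (D.out T₁ ℓ₀ w₀) = 1
  loop : Q × A × Λ → FreeMonoid A
  act_loop : ∀ b, D.act (D.ev (loop b)) T₀ = T₀
  next_loop : ∀ b, D.next T₀ (D.ev (loop b)) ℓ₀ = ℓ₀
  val_loop : ∀ b, val (D.out T₀ ℓ₀ (loop b)) = val (.of b)
  rep : G → FreeMonoid A
  -- The crucial property: once followed by `w₀`, a loop is determined in `S`, and not only in `G`,
  -- by its value.
  ev_mul_w₀ : ∀ w, D.act (D.ev w) T₀ = T₀ → D.next T₀ (D.ev w) ℓ₀ = ℓ₀ →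
    D.ev (w * w₀) = D.ev (w₀ * rep (val (D.out T₀ ℓ₀ w)))

namespace Presenting

variable {A S Q Λ G : Type*} [Monoid S] [Monoid G] {D : TransitionData A S Q Λ}
  (P : Presenting D G) (R : Set (FreeMonoid A × FreeMonoid A))

open TransitionData

/-- The defining relations for `G`. -/
def rels : Set (FreeMonoid (Q × A × Λ) × FreeMonoid (Q × A × Λ)) :=
  -- The first family transports the relations of `R`, the second turns every word into an output,
  -- and the third lets the output of `w₀` be appended.
  (fun x : (Q × Λ) × (FreeMonoid A × FreeMonoid A) =>
      (D.out x.1.1 x.1.2 x.2.1, D.out x.1.1 x.1.2 x.2.2)) '' (Set.univ ×ˢ R) ∪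
    (Set.range fun b => (FreeMonoid.of b, D.out P.T₀ P.ℓ₀ (P.loop b))) ∪
    {(D.out P.T₁ P.ℓ₀ P.w₀, 1)}

theorem finite_rels [Finite A] [Finite Q] [Finite Λ] (hR : R.Finite) : (P.rels R).Finite :=
  (((Set.finite_univ.prod hR).image _).union (Set.finite_range _)).union (Set.finite_singleton _)

theorem outRelated : D.OutRelated R (P.rels R) := fun r hr T ℓ =>
  Or.inl (Or.inl ⟨⟨⟨T, ℓ⟩, r⟩, ⟨trivial, hr⟩, rfl⟩)

variable {R}

theorem val_eq_of_mem_rels (hR : D.Respects R) {r : FreeMonoid (Q × A × Λ) × FreeMonoid (Q × A × Λ)}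
    (hr : r ∈ P.rels R) : P.val r.1 = P.val r.2 := by
  rcases hr with (⟨⟨⟨T, ℓ⟩, r⟩, ⟨-, hr⟩, rfl⟩ | ⟨b, rfl⟩) | rfl
  · exact P.val_out _ _ _ _ (hR r hr)
  · exact (P.val_loop b).symm
  · simpa using P.val_w₀

theorem val_side (hR : D.Respects R) (r : P.rels R) (ε : Bool) :
    P.val (side r.1 ε) = P.val r.1.1 := by
  cases ε
  · exact (P.val_eq_of_mem_rels hR r.2).symm
  · rfl

theorem val_tgt (hR : D.Respects R) (e : Edge (P.rels R)) : P.val e.tgt = P.val e.src := by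
  simp [Edge.src, Edge.tgt, P.val_side hR]

/-- A loop over `A` with the same value as a given word. -/
def loops : FreeMonoid (Q × A × Λ) →* FreeMonoid A := FreeMonoid.lift P.loop

theorem act_loops_and_next_loops (β : FreeMonoid (Q × A × Λ)) :
    D.act (D.ev (P.loops β)) P.T₀ = P.T₀ ∧ D.next P.T₀ (D.ev (P.loops β)) P.ℓ₀ = P.ℓ₀ := by
  induction β using FreeMonoid.inductionOn' with
  | one => simp [D.act_one, P.next_one]
  | of_mul b β ih =>
    have : P.loops (.of b) = P.loop b := FreeMonoid.lift_eval_of _ _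
    simp [this, D.act_mul, D.next_mul, ih.1, ih.2, P.act_loop, P.next_loop]

@[simp] theorem act_loops (β : FreeMonoid (Q × A × Λ)) :
    D.act (D.ev (P.loops β)) P.T₀ = P.T₀ := (P.act_loops_and_next_loops β).1

@[simp] theorem next_loops (β : FreeMonoid (Q × A × Λ)) :
    D.next P.T₀ (D.ev (P.loops β)) P.ℓ₀ = P.ℓ₀ := (P.act_loops_and_next_loops β).2

theorem out_loops_mul (β : FreeMonoid (Q × A × Λ)) {T : Q} {x : FreeMonoid A}
    (hx : D.act (D.ev x) T = P.T₀) :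
    D.out T P.ℓ₀ (P.loops β * x) = D.out P.T₀ P.ℓ₀ (P.loops β) * D.out T P.ℓ₀ x := by
  rw [out_mul, hx, next_loops]

theorem out_loops_map_mul (α β : FreeMonoid (Q × A × Λ)) :
    D.out P.T₀ P.ℓ₀ (P.loops (α * β)) =
      D.out P.T₀ P.ℓ₀ (P.loops α) * D.out P.T₀ P.ℓ₀ (P.loops β) := by
  rw [map_mul, out_loops_mul _ _ (P.act_loops β)]

theorem val_out_loops (β : FreeMonoid (Q × A × Λ)) :
    P.val (D.out P.T₀ P.ℓ₀ (P.loops β)) = P.val β := by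
  induction β using FreeMonoid.inductionOn' with
  | one => simp
  | of_mul b β ih =>
    have : P.loops (.of b) = P.loop b := FreeMonoid.lift_eval_of _ _
    rw [out_loops_map_mul, map_mul, map_mul, ih, this, P.val_loop]

theorem ev_loops_mul_w₀ (β : FreeMonoid (Q × A × Λ)) :
    D.ev (P.loops β * P.w₀) = D.ev (P.w₀ * P.rep (P.val β)) := by
  rw [P.ev_mul_w₀ _ (P.act_loops β) (P.next_loops β), val_out_loops]

variable (R)

/-- The path from `β` to the output of the loop of `β`. -/
def toLoopsList : List (Q × A × Λ) → List (Edge (P.rels R))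
  | [] => []
  | b :: β => ⟨1, ⟨_, Or.inl (Or.inr ⟨b, rfl⟩)⟩, true, .ofList β⟩ ::
      pathAct (D.out P.T₀ P.ℓ₀ (P.loop b)) (toLoopsList β) 1

/-- `toLoopsList` on the free monoid. -/
def toLoops (β : FreeMonoid (Q × A × Λ)) : List (Edge (P.rels R)) := P.toLoopsList R β.toList

theorem isPath_toLoops (β : FreeMonoid (Q × A × Λ)) :
    IsPath β (P.toLoops R β) (D.out P.T₀ P.ℓ₀ (P.loops β)) := by
  induction β using FreeMonoid.inductionOn' with
  | one => rfl
  | of_mul b β ih =>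
    have : P.loops (.of b) = P.loop b := FreeMonoid.lift_eval_of _ _
    rw [out_loops_map_mul, this]
    exact ⟨by simp [Edge.src, side], ih.act_left _⟩

theorem toLoops_mul (α β : FreeMonoid (Q × A × Λ)) :
    P.toLoops R (α * β) = pathAct 1 (P.toLoops R α) β ++
      pathAct (D.out P.T₀ P.ℓ₀ (P.loops α)) (P.toLoops R β) 1 := by
  induction α using FreeMonoid.inductionOn' with
  | one => simp [toLoops, toLoopsList]
  | of_mul b α ih =>
    have hb : P.loops (.of b) = P.loop b := FreeMonoid.lift_eval_of _ _
    have h : ∀ γ, P.toLoops R (.of b * γ) = ⟨1, ⟨_, Or.inl (Or.inr ⟨b, rfl⟩)⟩, true, γ⟩ ::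
      pathAct (D.out P.T₀ P.ℓ₀ (P.loop b)) (P.toLoops R γ) 1 := fun γ => rfl
    rw [mul_assoc, h, h, ih, out_loops_map_mul, hb]
    simp [Edge.act]

/-- The inverse of the edge `w₀ → 1`. -/
def unitEdge : Edge (P.rels R) := ⟨1, ⟨(D.out P.T₁ P.ℓ₀ P.w₀, 1), Or.inr rfl⟩, false, 1⟩

@[simp] theorem src_unitEdge : (P.unitEdge R).src = 1 := rfl

@[simp] theorem tgt_unitEdge : (P.unitEdge R).tgt = D.out P.T₁ P.ℓ₀ P.w₀ := by
  simp [unitEdge, Edge.tgt, side]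

variable {R}

/-- The path applying a relation and passing to the output of the loop. -/
def relToLoops (r : P.rels R) (ε : Bool) : List (Edge (P.rels R)) :=
  ⟨1, r, ε, 1⟩ :: P.toLoops R (side r.1 !ε)

theorem isPath_relToLoops (r : P.rels R) (ε : Bool) :
    IsPath (side r.1 ε) (P.relToLoops r ε) (D.out P.T₀ P.ℓ₀ (P.loops (side r.1 !ε))) := by
  refine ⟨by simp [Edge.src], ?_⟩
  simpa [Edge.tgt] using P.isPath_toLoops R (side r.1 !ε)

/-! ### The finite homotopy base -/

section Base

variable (σ : FreeMonoid A → FreeMonoid A → List (Edge R)) (X : Set (List (Edge R)))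

/-- The closed path comparing the two ways from one side of a relation, followed by the output of
`w₀` over `T`, to the output of its loop. -/
def relCircuit (r : P.rels R) (ε : Bool) (T : Q) : List (Edge (P.rels R)) :=
  pathAct 1 (P.relToLoops r ε) (D.out T P.ℓ₀ P.w₀) ++
    outPath (P.outRelated R) T P.ℓ₀
      (σ (P.loops (side r.1 !ε) * P.w₀) (P.loops (side r.1 ε) * P.w₀)) ++
    pathInv (pathAct 1 (P.toLoops R (side r.1 ε)) (D.out T P.ℓ₀ P.w₀))

/-- The homotopy base of the presentation of `G`. -/
def base : Set (List (Edge (P.rels R))) :=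
  (fun x : (Q × Λ) × List (Edge R) => outPath (P.outRelated R) x.1.1 x.1.2 x.2) ''
      (Set.univ ×ˢ X) ∪
    (fun x : (P.rels R) × Bool × Q => P.relCircuit σ x.1 x.2.1 x.2.2) ''
      -- Objects other than `T₁` are needed because `w₀` will be followed by a word z, and then ends
      -- over the image of `T₁` under z.
      {x | D.act (D.ev P.w₀) x.2.2 = P.T₀}

theorem finite_base [Finite A] [Finite Q] [Finite Λ] (hR : R.Finite) (hX : X.Finite) :
    (P.base σ X).Finite := by
  have : Finite (P.rels R) := P.finite_rels R hR
  exact ((Set.finite_univ.prod hX).image _).union ((Set.toFinite _).image _)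

variable {σ X} (hR : D.Respects R) (hσ : ∀ u v, D.ev u = D.ev v → IsPath u (σ u v) v)
include hR

theorem ev_loops_side_mul_w₀ (r : P.rels R) (ε ε' : Bool) :
    D.ev (P.loops (side r.1 ε) * P.w₀) = D.ev (P.loops (side r.1 ε') * P.w₀) := by
  rw [ev_loops_mul_w₀, ev_loops_mul_w₀, P.val_side hR, P.val_side hR]

include hσ

theorem isPath_relCircuit (r : P.rels R) (ε : Bool) {T : Q} (hT : D.act (D.ev P.w₀) T = P.T₀) :
    IsPath (side r.1 ε * D.out T P.ℓ₀ P.w₀) (P.relCircuit σ r ε T)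
      (side r.1 ε * D.out T P.ℓ₀ P.w₀) := by
  have h := isPath_outPath (P.outRelated R) hR T P.ℓ₀
    (hσ _ _ (P.ev_loops_side_mul_w₀ hR r (!ε) ε))
  rw [out_loops_mul _ _ hT, out_loops_mul _ _ hT] at h
  exact (((P.isPath_relToLoops r ε).act_right _).append h).append
    ((P.isPath_toLoops R _).act_right _).inv

theorem closed_of_mem_base (hX : ∀ p ∈ X, ∃ w, IsPath w p w) {p : List (Edge (P.rels R))}
    (hp : p ∈ P.base σ X) : ∃ w, IsPath w p w := by
  rcases hp with ⟨⟨⟨T, ℓ⟩, p⟩, ⟨-, hp⟩, rfl⟩ | ⟨⟨r, ε, T⟩, hT, rfl⟩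
  · obtain ⟨w, hw⟩ := hX p hp
    exact ⟨_, isPath_outPath _ hR T ℓ hw⟩
  · exact ⟨_, P.isPath_relCircuit hR hσ r ε hT⟩

omit hσ in
-- Parallel paths over `A` are homotopic modulo `X`, and the outputs of `X` belong to the base.
-- Hence any output leg may be exchanged for a parallel one.
theorem htp_outPath_base (hX : IsHomotopyBase X) (T : Q) (ℓ : Λ) {u v : FreeMonoid A}
    {p q : List (Edge R)} (hp : IsPath u p v) (hq : IsPath u q v) :
    Htp (P.base σ X) (D.out T ℓ u) (D.out T ℓ v) (outPath (P.outRelated R) T ℓ p)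
      (outPath (P.outRelated R) T ℓ q) :=
  htp_outPath _ hR hX.1 (fun p hp T ℓ => Or.inl ⟨⟨⟨T, ℓ⟩, p⟩, ⟨trivial, hp⟩, rfl⟩) T ℓ
    (htp_of_isHomotopyBase hX hp hq)

theorem htp_relCircuit (r : P.rels R) (ε : Bool) {T : Q} (hT : D.act (D.ev P.w₀) T = P.T₀) :
    Htp (P.base σ X) (side r.1 ε * D.out T P.ℓ₀ P.w₀)
      (D.out P.T₀ P.ℓ₀ (P.loops (side r.1 ε)) * D.out T P.ℓ₀ P.w₀)
      (pathAct 1 (P.relToLoops r ε) (D.out T P.ℓ₀ P.w₀) ++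
        outPath (P.outRelated R) T P.ℓ₀
          (σ (P.loops (side r.1 !ε) * P.w₀) (P.loops (side r.1 ε) * P.w₀)))
      (pathAct 1 (P.toLoops R (side r.1 ε)) (D.out T P.ℓ₀ P.w₀)) := by
  have h := isPath_outPath (P.outRelated R) hR T P.ℓ₀
    (hσ _ _ (P.ev_loops_side_mul_w₀ hR r (!ε) ε))
  rw [out_loops_mul _ _ hT, out_loops_mul _ _ hT] at h
  have h₁ : P.relCircuit σ r ε T ∈ definingPaths (P.base σ X) :=
    Or.inr ⟨1, 1, _, Or.inr ⟨⟨r, ε, T⟩, hT, rfl⟩, by simp⟩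
  have h₂ := Htp.of_mem h₁ (P.isPath_relCircuit hR hσ r ε hT)
  have h₃ := Htp.eq_append_pathInv ((P.isPath_toLoops R _).act_right _).inv h₂
    (((P.isPath_relToLoops r ε).act_right _).append h)
  simpa using h₃

end Base

end Presenting

end Squier

/-! ### Contraction to normal forms -/

namespace Squier

namespace Presenting

variable {A S Q Λ G : Type*} [Monoid S] [Monoid G] {D : TransitionData A S Q Λ}
  (P : Presenting D G) {R : Set (FreeMonoid A × FreeMonoid A)}

open TransitionData

variable (σ : FreeMonoid A → FreeMonoid A → List (Edge R)) (X : Set (List (Edge R)))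

/-- Compatibility of a relation with the passage to loops, followed by the output of `x`. -/
def Compat (r : P.rels R) (ε : Bool) (x : FreeMonoid A) : Prop :=
  Htp (P.base σ X) (side r.1 ε * D.out P.T₁ P.ℓ₀ x)
    (D.out P.T₀ P.ℓ₀ (P.loops (side r.1 ε)) * D.out P.T₁ P.ℓ₀ x)
    (pathAct 1 (P.relToLoops r ε) (D.out P.T₁ P.ℓ₀ x) ++
      outPath (P.outRelated R) P.T₁ P.ℓ₀
        (σ (P.loops (side r.1 !ε) * x) (P.loops (side r.1 ε) * x)))
    (pathAct 1 (P.toLoops R (side r.1 ε)) (D.out P.T₁ P.ℓ₀ x))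

variable {σ X} (hR : D.Respects R) (hσ : ∀ u v, D.ev u = D.ev v → IsPath u (σ u v) v)
  (hX : IsHomotopyBase X)
include hR hσ hX

/-- A circuit of the base, taken over the image of `T₁` under `z`, is translated on the right by the
output of `z`. Its output leg is then parallel, already over `A`, to the one required. -/
theorem compat_w₀_mul (r : P.rels R) (ε : Bool) {z : FreeMonoid A}
    (hz : D.act (D.ev P.w₀) (D.act (D.ev z) P.T₁) = P.T₀) : P.Compat σ X r ε (P.w₀ * z) := by
  have h₀ := hσ _ _ (P.ev_loops_side_mul_w₀ hR r (!ε) ε)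
  have h := (P.htp_relCircuit (X := X) hR hσ r ε hz).act_right
    (D.out P.T₁ (D.next (D.act (D.ev z) P.T₁) (D.ev P.w₀) P.ℓ₀) z)
  have h₁ := outPath_pathAct (P.outRelated R) hR P.T₁ P.ℓ₀ 1 z h₀
  simp only [out_one, map_mul, map_one, one_mul, D.act_mul, D.next_mul, hz, act_loops, next_loops,
    P.next_one] at h₁
  have h₂ := h₀.act_right z
  rw [mul_assoc, mul_assoc] at h₂
  have h₃ := hσ (P.loops (side r.1 !ε) * (P.w₀ * z)) (P.loops (side r.1 ε) * (P.w₀ * z)) (by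
    simpa [← mul_assoc] using congrArg (· * D.ev z) (P.ev_loops_side_mul_w₀ hR r (!ε) ε))
  have h₄ := P.htp_outPath_base (σ := σ) hR hX P.T₁ P.ℓ₀ h₃ h₂
  have hw : D.act (D.ev (P.w₀ * z)) P.T₁ = P.T₀ := by rw [map_mul, D.act_mul, hz]
  simp only [pathAct_append, ← h₁, pathAct_pathAct, one_mul, mul_assoc, ← out_mul] at h
  rw [Compat]
  rw [P.out_loops_mul _ hw, P.out_loops_mul _ hw] at h₄
  exact (h₄.append_left ((P.isPath_relToLoops r ε).act_right _)).trans h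

omit hσ hX in
-- A loop restores the object and the state, so as a prefix it contributes only a left factor.
theorem outPath_loops_act (β : FreeMonoid (Q × A × Λ)) {x y : FreeMonoid A} {ρ : List (Edge R)}
    (hρ : IsPath x ρ y) (hx : D.act (D.ev x) P.T₁ = P.T₀) :
    outPath (P.outRelated R) P.T₁ P.ℓ₀ (pathAct (P.loops β) ρ 1) =
      pathAct (D.out P.T₀ P.ℓ₀ (P.loops β)) (outPath (P.outRelated R) P.T₁ P.ℓ₀ ρ) 1 := by
  rw [outPath_pathAct _ hR _ _ _ _ hρ]
  simp [hx, D.act_one]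

/-- The output of `ρ` slides past both legs by exchange; what remains is a square of paths over `A`,
and the common initial path cancels. -/
theorem Compat.congr {r : P.rels R} {ε : Bool} {x y : FreeMonoid A} {ρ : List (Edge R)}
    (h : P.Compat σ X r ε x) (hρ : IsPath x ρ y) (hx : D.act (D.ev x) P.T₁ = P.T₀)
    (hr : D.ev (P.loops (side r.1 !ε) * x) = D.ev (P.loops (side r.1 ε) * x)) :
    P.Compat σ X r ε y := by
  have hxy := hR.ev_eq hρ
  have hy : D.act (D.ev y) P.T₁ = P.T₀ := hxy ▸ hx
  have hr' : D.ev (P.loops (side r.1 !ε) * y) = D.ev (P.loops (side r.1 ε) * y) := by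
    simpa [hxy] using hr
  have hρ' := isPath_outPath (P.outRelated R) hR P.T₁ P.ℓ₀ hρ
  have hp := isPath_outPath (P.outRelated R) hR P.T₁ P.ℓ₀ (hσ _ _ hr')
  rw [P.out_loops_mul _ hy, P.out_loops_mul _ hy] at hp
  have hl := (P.isPath_toLoops R (side r.1 ε))
  have hk := (P.isPath_relToLoops r ε)
  refine Htp.cancel_left (hρ'.act_left (side r.1 ε)) ((hk.act_right _).append hp)
    (hl.act_right _) ?_
  have h₁ := ((Htp.exchange (X := P.base σ X) hk hρ').symm).append_right hp
  have h₂ := Htp.exchange (X := P.base σ X) hl hρ'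
  have h₃ := h.append_right (hρ'.act_left _)
  have h₄ := P.htp_outPath_base (σ := σ) hR hX P.T₁ P.ℓ₀
    ((hρ.act_left (P.loops (side r.1 !ε))).append (hσ _ _ hr'))
    ((hσ _ _ hr).append (hρ.act_left (P.loops (side r.1 ε))))
  rw [P.out_loops_mul _ hx, P.out_loops_mul _ hy, outPath_append, outPath_append,
    P.outPath_loops_act hR _ hρ hx, P.outPath_loops_act hR _ hρ hx] at h₄
  have h₅ := h₄.append_left (hk.act_right (D.out P.T₁ P.ℓ₀ x))
  simp only [List.append_assoc] at h₁ h₂ h₃ h₅ ⊢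
  exact h₁.trans (h₅.trans (h₃.trans h₂))

/-- Here finitely many circuits serve all right contexts: in `S` the word `loops β * w₀` equals `w₀
* z` with `z = rep (val β)`, and compatibility is transported along a path joining them. -/
theorem compat_loops_mul_w₀ (r : P.rels R) (ε : Bool) (β : FreeMonoid (Q × A × Λ)) :
    P.Compat σ X r ε (P.loops β * P.w₀) := by
  have h := (P.ev_loops_mul_w₀ β).symm
  have hx : D.act (D.ev (P.w₀ * P.rep (P.val β))) P.T₁ = P.T₀ := by
    rw [h, map_mul, D.act_mul, P.act_w₀, act_loops]
  refine Compat.congr P hR hσ hX (P.compat_w₀_mul hR hσ hX r ε (by rwa [map_mul, D.act_mul] at hx))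
    (hσ _ _ h) hx ?_
  simpa [← mul_assoc] using congrArg (· * D.ev (P.rep (P.val β)))
    (P.ev_loops_side_mul_w₀ hR r (!ε) ε)

omit hσ hX in
theorem ev_loops_side_mul_loops_mul_w₀ (r : P.rels R) (ε ε' : Bool)
    (β : FreeMonoid (Q × A × Λ)) :
    D.ev (P.loops (side r.1 ε) * (P.loops β * P.w₀)) =
      D.ev (P.loops (side r.1 ε') * (P.loops β * P.w₀)) := by
  simp only [← mul_assoc, ← map_mul P.loops]
  rw [ev_loops_mul_w₀, ev_loops_mul_w₀, map_mul P.val, map_mul P.val, P.val_side hR,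
    P.val_side hR]

/-- Exchange lets the context `β` pass to its loop before the relation is applied, which reduces to
compatibility at `loops β * w₀`. -/
theorem htp_toLoops_of_rel (r : P.rels R) (ε : Bool) (β : FreeMonoid (Q × A × Λ)) :
    Htp (P.base σ X) (side r.1 ε * (β * D.out P.T₁ P.ℓ₀ P.w₀))
      (D.out P.T₁ P.ℓ₀ (P.loops (side r.1 ε) * (P.loops β * P.w₀)))
      (⟨1, r, ε, β * D.out P.T₁ P.ℓ₀ P.w₀⟩ ::
        pathAct 1 (P.toLoops R (side r.1 (!ε) * β)) (D.out P.T₁ P.ℓ₀ P.w₀) ++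
        outPath (P.outRelated R) P.T₁ P.ℓ₀ (σ (P.loops (side r.1 !ε) * (P.loops β * P.w₀))
          (P.loops (side r.1 ε) * (P.loops β * P.w₀))))
      (pathAct 1 (P.toLoops R (side r.1 ε * β)) (D.out P.T₁ P.ℓ₀ P.w₀)) := by
  have hw : D.act (D.ev (P.loops β * P.w₀)) P.T₁ = P.T₀ := by
    rw [map_mul, D.act_mul, P.act_w₀, act_loops]
  have hl := P.isPath_toLoops R (side r.1 ε)
  have hk := P.isPath_relToLoops r ε
  have hβ := (P.isPath_toLoops R β).act_right (D.out P.T₁ P.ℓ₀ P.w₀)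
  have hc := P.compat_loops_mul_w₀ hR hσ hX r ε β
  rw [Compat, P.out_loops_mul β P.act_w₀] at hc
  have hp := isPath_outPath (P.outRelated R) hR P.T₁ P.ℓ₀
    (hσ _ _ (P.ev_loops_side_mul_loops_mul_w₀ hR r (!ε) ε β))
  rw [P.out_loops_mul _ hw, P.out_loops_mul _ hw, P.out_loops_mul β P.act_w₀] at hp
  have h₁ := (Htp.exchange (X := P.base σ X) hk hβ).append_right hp
  have h₂ := hc.append_left (hβ.act_left (side r.1 ε))
  have h₃ := (Htp.exchange (X := P.base σ X) hl hβ).symm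
  rw [P.out_loops_mul _ hw, P.out_loops_mul β P.act_w₀, toLoops_mul, toLoops_mul]
  simp only [List.append_assoc, pathAct_append, pathAct_pathAct, one_mul, mul_one, relToLoops,
    pathAct_cons, Edge.act, List.cons_append] at h₁ h₂ h₃ ⊢
  exact h₁.trans (h₂.trans h₃)

/-- The left context is disjoint from the relation, so its passage to loops commutes with the edge.
-/
theorem htp_toLoops_of_act (α : FreeMonoid (Q × A × Λ)) (r : P.rels R) (ε : Bool)
    (β : FreeMonoid (Q × A × Λ)) :
    Htp (P.base σ X) (α * (side r.1 ε * (β * D.out P.T₁ P.ℓ₀ P.w₀)))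
      (D.out P.T₀ P.ℓ₀ (P.loops α) *
        D.out P.T₁ P.ℓ₀ (P.loops (side r.1 ε) * (P.loops β * P.w₀)))
      (⟨α, r, ε, β * D.out P.T₁ P.ℓ₀ P.w₀⟩ ::
        pathAct 1 (P.toLoops R (α * (side r.1 (!ε) * β))) (D.out P.T₁ P.ℓ₀ P.w₀) ++
        outPath (P.outRelated R) P.T₁ P.ℓ₀
          (pathAct (P.loops α) (σ (P.loops (side r.1 !ε) * (P.loops β * P.w₀))
            (P.loops (side r.1 ε) * (P.loops β * P.w₀))) 1))
      (pathAct 1 (P.toLoops R (α * (side r.1 ε * β))) (D.out P.T₁ P.ℓ₀ P.w₀)) := by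
  have hw : D.act (D.ev (P.loops β * P.w₀)) P.T₁ = P.T₀ := by
    rw [map_mul, D.act_mul, P.act_w₀, act_loops]
  have hw' : ∀ ε, D.act (D.ev (P.loops (side r.1 ε) * (P.loops β * P.w₀))) P.T₁ = P.T₀ := by
    intro ε
    rw [map_mul, D.act_mul, hw, act_loops]
  have hα := P.isPath_toLoops R α
  have h₁ := P.htp_toLoops_of_rel hR hσ hX r ε β
  have hρ := hσ _ _ (P.ev_loops_side_mul_loops_mul_w₀ hR r (!ε) ε β)
  rw [P.outPath_loops_act hR _ hρ (hw' _)]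
  have hp := isPath_outPath (P.outRelated R) hR P.T₁ P.ℓ₀ hρ
  generalize outPath (P.outRelated R) P.T₁ P.ℓ₀
    (σ (P.loops (side r.1 !ε) * (P.loops β * P.w₀))
      (P.loops (side r.1 ε) * (P.loops β * P.w₀))) = ρ at h₁ hp ⊢
  have hr : IsPath (side r.1 ε * (β * D.out P.T₁ P.ℓ₀ P.w₀))
      [⟨1, r, ε, β * D.out P.T₁ P.ℓ₀ P.w₀⟩] (side r.1 (!ε) * (β * D.out P.T₁ P.ℓ₀ P.w₀)) := by
    simp [Edge.src, Edge.tgt]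
  have h₂ := (h₁.act_left (D.out P.T₀ P.ℓ₀ (P.loops α))).append_left (hα.act_right _)
  have h₃ := (Htp.exchange (X := P.base σ X) hα hr).symm
  have hl := (P.isPath_toLoops R (side r.1 (!ε) * β)).act_right (D.out P.T₁ P.ℓ₀ P.w₀)
  rw [← P.out_loops_mul _ P.act_w₀, map_mul, mul_assoc, mul_assoc] at hl
  have h₄ := h₃.append_right ((hl.append hp).act_left (D.out P.T₀ P.ℓ₀ (P.loops α)))
  rw [P.toLoops_mul R α, P.toLoops_mul R α]
  simp only [List.append_assoc, pathAct_append, pathAct_pathAct, one_mul, mul_one, mul_assoc,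
    pathAct_cons, pathAct_nil, Edge.act, List.cons_append, List.nil_append] at h₂ h₄ ⊢
  exact h₄.trans h₂

omit hσ hX in
theorem ev_loops_tgt (e : Edge (P.rels R)) :
    D.ev (P.loops e.tgt * P.w₀) = D.ev (P.loops e.src * P.w₀) := by
  rw [ev_loops_mul_w₀, ev_loops_mul_w₀, P.val_tgt hR]

/-- The last leg of `htp_toLoops_of_act` is the output of a path prefixed by `loops α`; it is
replaced by the output of the parallel path chosen by `σ`. -/
theorem htp_toLoops_of_edge (e : Edge (P.rels R)) :
    Htp (P.base σ X) (e.src * D.out P.T₁ P.ℓ₀ P.w₀) (D.out P.T₁ P.ℓ₀ (P.loops e.src * P.w₀))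
      (e.act 1 (D.out P.T₁ P.ℓ₀ P.w₀) :: pathAct 1 (P.toLoops R e.tgt) (D.out P.T₁ P.ℓ₀ P.w₀) ++
        outPath (P.outRelated R) P.T₁ P.ℓ₀ (σ (P.loops e.tgt * P.w₀) (P.loops e.src * P.w₀)))
      (pathAct 1 (P.toLoops R e.src) (D.out P.T₁ P.ℓ₀ P.w₀)) := by
  have hσe := hσ _ _ (P.ev_loops_tgt hR e)
  obtain ⟨α, r, ε, β⟩ := e
  have hw : D.act (D.ev (P.loops (side r.1 ε) * (P.loops β * P.w₀))) P.T₁ = P.T₀ := by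
    rw [map_mul, D.act_mul, map_mul, D.act_mul, P.act_w₀, act_loops, act_loops]
  have h := P.htp_toLoops_of_act hR hσ hX α r ε β
  have hρ := (hσ _ _ (P.ev_loops_side_mul_loops_mul_w₀ hR r (!ε) ε β)).act_left (P.loops α)
  simp only [Edge.src, Edge.tgt, map_mul, mul_assoc, Edge.act, one_mul] at hσe ⊢
  have h₁ := P.htp_outPath_base (σ := σ) hR hX P.T₁ P.ℓ₀ hσe hρ
  have hα := (P.isPath_toLoops R (α * (side r.1 (!ε) * β))).act_right (D.out P.T₁ P.ℓ₀ P.w₀)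
  rw [← P.out_loops_mul _ P.act_w₀] at hα
  simp only [map_mul, mul_assoc] at hα
  have h₂ := (h₁.append_left hα).append_left (w := α * (side r.1 ε * (β * D.out P.T₁ P.ℓ₀ P.w₀)))
    (a := [⟨α, r, ε, β * D.out P.T₁ P.ℓ₀ P.w₀⟩]) (by simp [Edge.src, Edge.tgt, mul_assoc])
  rw [P.out_loops_mul α hw]
  rw [P.out_loops_mul α hw] at h₂
  simpa using h₂.trans (by simpa using h)

omit hσ hX hR in
variable (R) in
theorem isPath_unitEdge (β : FreeMonoid (Q × A × Λ)) :
    IsPath β [(P.unitEdge R).act β 1] (β * D.out P.T₁ P.ℓ₀ P.w₀) := by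
  simp

variable (σ) in
/-- The path from a word to its normal form. -/
def toNormalForm (β : FreeMonoid (Q × A × Λ)) : List (Edge (P.rels R)) :=
  (P.unitEdge R).act β 1 :: (pathAct 1 (P.toLoops R β) (D.out P.T₁ P.ℓ₀ P.w₀) ++
    outPath (P.outRelated R) P.T₁ P.ℓ₀ (σ (P.loops β * P.w₀) (P.w₀ * P.rep (P.val β))))

omit hX in
theorem isPath_toNormalForm (β : FreeMonoid (Q × A × Λ)) :
    IsPath β (P.toNormalForm σ β) (D.out P.T₁ P.ℓ₀ (P.w₀ * P.rep (P.val β))) := by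
  have h := isPath_outPath (P.outRelated R) hR P.T₁ P.ℓ₀ (hσ _ _ (P.ev_loops_mul_w₀ β))
  rw [P.out_loops_mul _ P.act_w₀] at h
  exact (P.isPath_unitEdge R β).append (((P.isPath_toLoops R β).act_right _).append h)

/-- The unit edge commutes with `e` by exchange, the passage to loops is `htp_toLoops_of_edge`, and
the final legs are outputs of parallel paths because `val` agrees at both ends of `e`. -/
theorem htp_toNormalForm (e : Edge (P.rels R)) :
    Htp (P.base σ X) e.src (D.out P.T₁ P.ℓ₀ (P.w₀ * P.rep (P.val e.src)))
      (e :: P.toNormalForm σ e.tgt) (P.toNormalForm σ e.src) := by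
  have he : IsPath e.src [e] e.tgt := by simp
  have h₀ := P.isPath_unitEdge R 1
  rw [one_mul] at h₀
  have hσt := hσ _ _ (P.ev_loops_mul_w₀ e.tgt)
  have hσs := hσ _ _ (P.ev_loops_mul_w₀ e.src)
  have hσe := hσ _ _ (P.ev_loops_tgt hR e)
  have ht := isPath_outPath (P.outRelated R) hR P.T₁ P.ℓ₀ hσt
  have hs := isPath_outPath (P.outRelated R) hR P.T₁ P.ℓ₀ hσs
  rw [P.val_tgt hR, P.out_loops_mul _ P.act_w₀] at ht
  have hl := (P.isPath_toLoops R e.tgt).act_right (D.out P.T₁ P.ℓ₀ P.w₀)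
  have h₁ := (Htp.exchange (X := P.base σ X) he h₀).append_right (hl.append ht)
  have h₂ := (P.htp_toLoops_of_edge hR hσ hX e).append_right hs
  rw [P.val_tgt hR] at hσt
  have h₃ := P.htp_outPath_base (σ := σ) hR hX P.T₁ P.ℓ₀ hσt (hσe.append hσs)
  have he' := he.act_right (D.out P.T₁ P.ℓ₀ P.w₀)
  rw [P.out_loops_mul _ P.act_w₀] at h₃
  have h₄ := h₃.append_left (he'.append hl)
  have h₅ := (h₄.trans (by simpa using h₂)).append_left (P.isPath_unitEdge R e.src)
  simpa [toNormalForm, P.val_tgt hR] using h₁.trans (by simpa using h₅)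

theorem isHomotopyBase_base : IsHomotopyBase (P.base σ X) :=
  isHomotopyBase_of_contraction (fun _ hp => P.closed_of_mem_base hR hσ hX.1 hp)
    (fun β => D.out P.T₁ P.ℓ₀ (P.w₀ * P.rep (P.val β))) (P.toNormalForm σ)
    (P.isPath_toNormalForm hR hσ) (fun e => by rw [P.val_tgt hR])
    (fun e => P.htp_toNormalForm hR hσ hX e)

omit hX in
variable (R) in
-- Injectivity: words of equal value are joined to the same normal form.
theorem nonempty_mulEquiv :
    Nonempty (PresentedMonoid (fun u v => (u, v) ∈ P.rels R) ≃* G) := by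
  have hlift : FreeMonoid.lift (fun b => P.val (.of b)) = P.val := FreeMonoid.hom_eq fun _ => by
    simp
  let φ : PresentedMonoid (fun u v => (u, v) ∈ P.rels R) →* G :=
    PresentedMonoid.lift (fun b => P.val (.of b)) fun a b hab => by
      rw [hlift]
      exact P.val_eq_of_mem_rels hR hab
  have hφ : ∀ u, φ (PresentedMonoid.mk _ u) = P.val u := fun u => by
    rw [← hlift]
    rfl
  refine ⟨MulEquiv.ofBijective φ ⟨fun x y hxy => ?_, fun g => ?_⟩⟩
  · induction x with | _ u
    induction y with | _ v
    rw [hφ, hφ] at hxy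
    have hu := P.isPath_toNormalForm hR hσ u
    have hv := P.isPath_toNormalForm hR hσ v
    rw [hxy] at hu
    exact mk_eq_mk_iff_exists_isPath.2 ⟨_, hu.append hv.inv⟩
  · obtain ⟨u, rfl⟩ := P.val_surjective g
    exact ⟨_, hφ u⟩

omit hR hσ hX in
/-- A monoid presented by transition data over a monoid with finite derivation type has finite
derivation type. -/
theorem monoidFDT {A Q Λ : Type} {D : TransitionData A S Q Λ} (P : Presenting D G)
    {R : Set (FreeMonoid A × FreeMonoid A)} [Finite A] [Finite Q] [Finite Λ] (hRfin : R.Finite)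
    (hR : D.Respects R)
    (hev : ∀ u v, D.ev u = D.ev v → PresentedMonoid.mk (fun x y => (x, y) ∈ R) u =
      PresentedMonoid.mk (fun x y => (x, y) ∈ R) v)
    (hfdt : PresentationFDT R) : MonoidFDT G := by
  obtain ⟨X, hXfin, hX⟩ := hfdt
  -- The empty list is a default for pairs with different values in `S`.
  have : ∀ u v : FreeMonoid A, ∃ p : List (Edge R), D.ev u = D.ev v → IsPath u p v := fun u v => by
    by_cases h : D.ev u = D.ev v
    · obtain ⟨p, hp⟩ := mk_eq_mk_iff_exists_isPath.1 (hev u v h)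
      exact ⟨p, fun _ => hp⟩
    · exact ⟨[], fun h' => absurd h' h⟩
  choose σ hσ using this
  exact ⟨_, P.rels R, inferInstance, P.finite_rels R hRfin, P.nonempty_mulEquiv R hR hσ,
    P.base σ X, P.finite_base σ X hRfin hXfin, P.isHomotopyBase_base hR hσ hX⟩

end Presenting

end Squier

/-! ### Green's relations and the left stabilizer -/

section Green

variable {S : Type*} [Monoid S] {a b c : S}

theorem GreenR.refl (a : S) : GreenR a a := ⟨⟨1, by simp⟩, 1, by simp⟩

theorem GreenR.symm (h : GreenR a b) : GreenR b a := ⟨h.2, h.1⟩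

theorem GreenR.trans (h : GreenR a b) (h' : GreenR b c) : GreenR a c := by
  obtain ⟨⟨x, rfl⟩, y, hy⟩ := h
  obtain ⟨⟨z, rfl⟩, w, hw⟩ := h'
  refine ⟨⟨z * x, by simp [mul_assoc]⟩, y * w, ?_⟩
  rw [← mul_assoc, ← hy, ← hw]

theorem GreenR.mul_left (h : GreenR a b) (c : S) : GreenR (c * a) (c * b) := by
  obtain ⟨⟨x, hx⟩, y, hy⟩ := h
  exact ⟨⟨x, by rw [mul_assoc, ← hx]⟩, y, by rw [mul_assoc, ← hy]⟩

theorem GreenL.refl (a : S) : GreenL a a := ⟨⟨1, by simp⟩, 1, by simp⟩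

theorem GreenL.symm (h : GreenL a b) : GreenL b a := ⟨h.2, h.1⟩

theorem GreenL.trans (h : GreenL a b) (h' : GreenL b c) : GreenL a c := by
  obtain ⟨⟨x, rfl⟩, y, hy⟩ := h
  obtain ⟨⟨z, rfl⟩, w, hw⟩ := h'
  refine ⟨⟨x * z, by simp [mul_assoc]⟩, w * y, ?_⟩
  rw [mul_assoc, ← hy, ← hw]

theorem GreenL.mul_right (h : GreenL a b) (c : S) : GreenL (a * c) (b * c) := by
  obtain ⟨⟨x, hx⟩, y, hy⟩ := h
  exact ⟨⟨x, by rw [← mul_assoc, ← hx]⟩, y, by rw [← mul_assoc, ← hy]⟩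

theorem GreenH.refl (a : S) : GreenH a a := ⟨.refl a, .refl a⟩

/-- Left multiplication by an element that maps `h` into its `H`-class permutes the `L`-classes of
the `R`-class of `h` trivially. -/
theorem GreenL.mul_left_of_greenR {q h y : S} (hq : GreenL (q * h) h) (hy : GreenR y h) :
    GreenL (q * y) y := by
  obtain ⟨⟨x, rfl⟩, -⟩ := hy
  simpa [mul_assoc] using hq.mul_right x

/-- Two `L`-related elements of the `R`-class of `h` differ by left multiplication with an element
that maps `h` into its `H`-class. -/
theorem exists_mul_of_greenL {h y z : S} (hy : GreenR y h) (hz : GreenR z h) (hyz : GreenL y z) :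
    ∃ q, y = q * z ∧ GreenH (q * h) h := by
  obtain ⟨⟨q, rfl⟩, q', hq'⟩ := hyz
  refine ⟨q, rfl, (hz.symm.mul_left q).trans hy, ?_⟩
  have hL : GreenL (q * z) z := ⟨⟨q, rfl⟩, q', hq'⟩
  exact GreenL.mul_left_of_greenR hL hz.symm

theorem eq_of_mul_greenR {h y q q' : S} (hy : GreenR y h) (hq : q * y = q' * y) :
    q * h = q' * h := by
  obtain ⟨-, x, rfl⟩ := hy
  rw [← mul_assoc, hq, mul_assoc]

/-- Green's lemma: if h x d = h, then right multiplications by x and by d are mutually inverse on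
the H-class, whose members are left multiples both of h and of h x. -/
theorem mem_rightStab_of_greenH {h x : S} (hx : GreenH (h * x) h) :
    x ∈ rightStab {y | GreenH y h} := by
  obtain ⟨⟨-, d, hd⟩, hL⟩ := hx
  change (fun y => y * x) '' {y | GreenH y h} = {y | GreenH y h}
  ext y
  constructor
  · rintro ⟨y, hy : GreenH y h, rfl⟩
    have hy' : GreenR (y * x) y := by
      obtain ⟨-, ⟨u, rfl⟩, -⟩ := hy
      exact ⟨⟨x, rfl⟩, d, by rw [mul_assoc, mul_assoc, ← mul_assoc h, ← hd]⟩
    exact ⟨hy'.trans hy.1, (hy.2.mul_right x).trans hL⟩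
  · intro (hy : GreenH y h)
    have hyx : GreenL y (h * x) := hy.2.trans hL.symm
    have hyd : y * d * x = y := by
      obtain ⟨⟨v, rfl⟩, -⟩ := hyx
      rw [mul_assoc v, ← hd, mul_assoc]
    refine ⟨y * d, ⟨GreenR.trans ⟨⟨d, rfl⟩, x, hyd.symm⟩ hy.1, ?_⟩, hyd⟩
    have := hyx.mul_right d
    rwa [← hd] at this

/-- The classes of a kernel with finitely many values, indexed by an initial segment. -/
theorem exists_fin_classes {α β : Type*} [Finite β] (f : α → β) :
    ∃ (n : ℕ) (c : α → Fin n), Function.Surjective c ∧ ∀ x y, c x = c y ↔ f x = f y := by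
  obtain ⟨n, ⟨e⟩⟩ := Finite.exists_equiv_fin (Set.range f)
  refine ⟨n, fun x => e ⟨f x, x, rfl⟩, fun i => ?_,
    fun x y => e.injective.eq_iff.trans Subtype.ext_iff⟩
  obtain ⟨⟨_, x, rfl⟩, rfl⟩ := e.surjective i
  exact ⟨x, rfl⟩

variable (S) in
-- The sub-actions are the right ideals, the empty one included, and R-classes correspond to
-- principal right ideals.
theorem exists_fin_greenR [Finite (SubMulAction Sᵐᵒᵖ S)] :
    ∃ (n : ℕ) (c : S → Fin n), Function.Surjective c ∧ ∀ x y, c x = c y ↔ GreenR x y := by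
  let f : S → SubMulAction Sᵐᵒᵖ S := fun s =>
    { carrier := {y | ∃ x, y = s * x}
      smul_mem' := by
        rintro c _ ⟨x, rfl⟩
        exact ⟨x * c.unop, by simp [mul_assoc, MulOpposite.smul_eq_mul_unop]⟩ }
  have hf : ∀ s y, y ∈ f s ↔ ∃ x, y = s * x := fun _ _ => Iff.rfl
  obtain ⟨n, c, hc, h⟩ := exists_fin_classes f
  refine ⟨n, c, hc, fun x y => (h x y).trans ⟨fun e => ⟨?_, ?_⟩, fun e => ?_⟩⟩
  · exact (hf _ _).1 (e ▸ (hf x x).2 ⟨1, by simp⟩)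
  · exact (hf _ _).1 (e ▸ (hf y y).2 ⟨1, by simp⟩)
  · ext z
    obtain ⟨⟨u, hu⟩, v, hv⟩ := e
    rw [hf, hf]
    constructor
    · rintro ⟨w, rfl⟩
      exact ⟨u * w, by rw [← mul_assoc, ← hu]⟩
    · rintro ⟨w, rfl⟩
      exact ⟨v * w, by rw [← mul_assoc, ← hv]⟩

variable (S) in
theorem exists_fin_greenL [Finite (SubMulAction S S)] :
    ∃ (n : ℕ) (c : S → Fin n), ∀ x y, c x = c y ↔ GreenL x y := by
  let f : S → SubMulAction S S := fun s =>
    { carrier := {y | ∃ x, y = x * s}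
      smul_mem' := by
        rintro c _ ⟨x, rfl⟩
        exact ⟨c * x, by simp [mul_assoc]⟩ }
  have hf : ∀ s y, y ∈ f s ↔ ∃ x, y = x * s := fun _ _ => Iff.rfl
  obtain ⟨n, c, -, h⟩ := exists_fin_classes f
  refine ⟨n, c, fun x y => (h x y).trans ⟨fun e => ⟨?_, ?_⟩, fun e => ?_⟩⟩
  · exact (hf _ _).1 (e ▸ (hf x x).2 ⟨1, by simp⟩)
  · exact (hf _ _).1 (e ▸ (hf y y).2 ⟨1, by simp⟩)
  · ext z
    obtain ⟨⟨u, hu⟩, v, hv⟩ := e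
    rw [hf, hf]
    constructor
    · rintro ⟨w, rfl⟩
      exact ⟨w * u, by rw [mul_assoc, ← hu]⟩
    · rintro ⟨w, rfl⟩
      exact ⟨w * v, by rw [mul_assoc, ← hv]⟩

/-- The left stabilizer of the `H`-class of `h`. -/
def leftStab (h : S) : Submonoid S where
  carrier := {q | GreenH (q * h) h}
  one_mem' := by simpa using GreenH.refl h
  mul_mem' := by
    intro q q' (hq : GreenH (q * h) h) (hq' : GreenH (q' * h) h)
    refine ⟨?_, ?_⟩
    · simpa [mul_assoc] using (hq'.1.mul_left q).trans hq.1
    · simpa [mul_assoc] using (GreenL.mul_left_of_greenR hq.2 hq'.1).trans hq'.2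

theorem mem_leftStab {h q : S} : q ∈ leftStab h ↔ GreenH (q * h) h := Iff.rfl

/-- The Schützenberger group is a quotient of the left stabilizer. -/
theorem exists_leftStab_hom (h : S) :
    ∃ τ : leftStab h →* SchutzenbergerGroup {x | GreenH x h}, Function.Surjective τ ∧
      ∀ q q', τ q = τ q' ↔ (q : S) * h = q' * h := by
  -- From q h = h x and q' h = h x' follows q q' h = q h x' = h x x', so q ↦ x preserves the order
  -- of products.
  have key : ∀ q : leftStab h, ∃ x : rightStab {x | GreenH x h}, (q : S) * h = h * x := by
    intro q
    obtain ⟨x, hx⟩ := q.2.1.1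
    refine ⟨⟨x, mem_rightStab_of_greenH ?_⟩, hx⟩
    rw [← hx]
    exact q.2
  choose r hr using key
  have hrel : ∀ x y : rightStab {x | GreenH x h},
      (x : SchutzenbergerGroup {x | GreenH x h}) = y ↔ h * (x : S) = h * y := by
    intro x y
    rw [Con.eq]
    constructor
    · exact fun H => H h (GreenH.refl h)
    · rintro H z ⟨-, ⟨u, rfl⟩, -⟩
      rw [mul_assoc, mul_assoc, H]
  refine ⟨⟨⟨fun q => (r q : SchutzenbergerGroup {x | GreenH x h}), ?_⟩, ?_⟩, ?_, ?_⟩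
  · rw [← Con.coe_one, hrel, ← hr]
    simp
  · intro q q'
    rw [← Con.coe_mul, hrel, ← hr]
    simp only [Submonoid.coe_mul]
    rw [mul_assoc, hr q', ← mul_assoc, hr q, mul_assoc]
  · intro g
    induction g using Con.induction_on with
    | H x =>
      have hx : GreenH (h * (x : S)) h :=
        (show (fun y => y * (x : S)) '' {y | GreenH y h} = {y | GreenH y h} from x.2).subset
          ⟨h, GreenH.refl h, rfl⟩
      obtain ⟨q, hq⟩ := hx.2.1
      refine ⟨⟨q, ?_⟩, ?_⟩
      · rw [mem_leftStab, ← hq]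
        exact hx
      · change ((r _ : rightStab {x | GreenH x h}) : SchutzenbergerGroup {x | GreenH x h}) = x
        rw [hrel, ← hr]
        exact hq.symm
  · intro q q'
    change ((r q : rightStab {x | GreenH x h}) : SchutzenbergerGroup {x | GreenH x h}) = r q' ↔ _
    rw [hrel, ← hr, ← hr]

end Green

/-- Choices of representatives for the `R`-classes and of multipliers into the `R`-class of `h`,
indexed by the `L`-classes that they reach. -/
structure GreenData {S : Type*} [Monoid S] (h : S) (Q Λ : Type*) where
  clsR : S → Q
  clsR_eq : ∀ x y, clsR x = clsR y ↔ GreenR x y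
  rep : Q → S
  clsR_rep : ∀ T, clsR (rep T) = T
  clsL : S → Λ
  clsL_eq : ∀ x y, clsL x = clsL y ↔ GreenL x y
  mult : Q → Λ → S
  mult_spec : ∀ T ℓ, (∃ p, GreenR (p * rep T) h ∧ clsL (p * rep T) = ℓ) →
    GreenR (mult T ℓ * rep T) h ∧ clsL (mult T ℓ * rep T) = ℓ
  -- A trivial multiplier at the base makes the value of a loop there the class of the element it
  -- represents.
  mult_base : mult (clsR h) (clsL (rep (clsR h))) = 1

/-! ### Transitions between R-classes -/

namespace GreenData

open Squier

variable {S : Type*} [Monoid S] {h : S} {Q Λ : Type*} (C : GreenData h Q Λ)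

/-- Some left multiple of the class `T` lies in the `R`-class of `h` and in the `L`-class `ℓ`. -/
def Valid (T : Q) (ℓ : Λ) : Prop := ∃ p, GreenR (p * C.rep T) h ∧ C.clsL (p * C.rep T) = ℓ

variable {C} in
theorem Valid.greenR {T : Q} {ℓ : Λ} (hv : C.Valid T ℓ) : GreenR (C.mult T ℓ * C.rep T) h :=
  (C.mult_spec T ℓ hv).1

variable {C} in
theorem Valid.clsL_mult {T : Q} {ℓ : Λ} (hv : C.Valid T ℓ) :
    C.clsL (C.mult T ℓ * C.rep T) = ℓ :=
  (C.mult_spec T ℓ hv).2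

theorem greenR_rep (x : S) : GreenR (C.rep (C.clsR x)) x := by
  rw [← C.clsR_eq, C.clsR_rep]

/-- The left action on `R`-classes. -/
def act (s : S) (T : Q) : Q := C.clsR (s * C.rep T)

theorem act_one (T : Q) : C.act 1 T = T := by simp [act, C.clsR_rep]

theorem act_mul (s t : S) (T : Q) : C.act (s * t) T = C.act s (C.act t T) := by
  rw [act, act, C.clsR_eq, mul_assoc]
  exact ((C.greenR_rep _).mul_left s).symm

theorem greenR_rep_act (s : S) (T : Q) : GreenR (C.rep (C.act s T)) (s * C.rep T) :=
  C.greenR_rep _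

open Classical in
/-- The transition function on `L`-classes, with `none` as a sink. -/
noncomputable def next (T : Q) (s : S) : Option Λ → Option Λ
  | none => none
  | some ℓ => if C.Valid (C.act s T) ℓ then some (C.clsL (C.mult (C.act s T) ℓ * s * C.rep T))
    else none

variable {C} in
theorem Valid.next_eq {T : Q} {s : S} {ℓ : Λ} (hv : C.Valid (C.act s T) ℓ) :
    C.next T s (some ℓ) = some (C.clsL (C.mult (C.act s T) ℓ * s * C.rep T)) := if_pos hv

theorem next_of_not_valid {T : Q} {s : S} {ℓ : Λ} (hv : ¬ C.Valid (C.act s T) ℓ) :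
    C.next T s (some ℓ) = none := if_neg hv

variable {C} in
theorem Valid.greenR_mul {T : Q} {s : S} {ℓ : Λ} (hv : C.Valid (C.act s T) ℓ) :
    GreenR (C.mult (C.act s T) ℓ * s * C.rep T) h := by
  rw [mul_assoc]
  exact ((C.greenR_rep_act s T).symm.mul_left _).trans hv.greenR

variable {C} in
theorem Valid.valid_next {T : Q} {s : S} {ℓ : Λ} (hv : C.Valid (C.act s T) ℓ) :
    C.Valid T (C.clsL (C.mult (C.act s T) ℓ * s * C.rep T)) :=
  ⟨_, hv.greenR_mul, rfl⟩

variable {C} in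
theorem Valid.greenL_next {T : Q} {s : S} {ℓ : Λ} (hv : C.Valid (C.act s T) ℓ) :
    GreenL (C.mult T (C.clsL (C.mult (C.act s T) ℓ * s * C.rep T)) * C.rep T)
      (C.mult (C.act s T) ℓ * s * C.rep T) := by
  rw [← C.clsL_eq]
  exact hv.valid_next.clsL_mult

variable {C} in
/-- Multipliers along a composite transition agree up to Green's relation `L`. -/
theorem Valid.clsL_mul {T : Q} {s t : S} {ℓ : Λ} (hv : C.Valid (C.act s (C.act t T)) ℓ) :
    C.clsL (C.mult (C.act t T) (C.clsL (C.mult (C.act s (C.act t T)) ℓ * s * C.rep (C.act t T))) *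
      t * C.rep T) = C.clsL (C.mult (C.act s (C.act t T)) ℓ * (s * t) * C.rep T) := by
  rw [C.clsL_eq]
  -- Right multiplication by `c` carries the representative of the class of `t * rep T` to `t * rep
  -- T`, and L is a right congruence.
  obtain ⟨-, c, hc⟩ := C.greenR_rep_act t T
  have := hv.greenL_next.mul_right c
  simpa only [mul_assoc, hc] using this

theorem next_mul (T : Q) (s t : S) (o : Option Λ) :
    C.next T (s * t) o = C.next T t (C.next (C.act t T) s o) := by
  cases o with
  | none => rfl
  | some ℓ =>
    by_cases hv : C.Valid (C.act s (C.act t T)) ℓ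
    · have hv' : C.Valid (C.act (s * t) T) ℓ := by rwa [C.act_mul]
      rw [hv'.next_eq, hv.next_eq, hv.valid_next.next_eq, hv.clsL_mul, C.act_mul]
    · have hv' : ¬ C.Valid (C.act (s * t) T) ℓ := by rwa [C.act_mul]
      rw [C.next_of_not_valid hv, C.next_of_not_valid hv']
      rfl

/-- The transitions between `R`-classes over a generating set. -/
noncomputable def transitionData {A : Type*} (ev : FreeMonoid A →* S) :
    TransitionData A S Q (Option Λ) where
  ev := ev
  act := C.act
  act_one := C.act_one
  act_mul := C.act_mul
  next := C.next
  next_mul := C.next_mul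

variable {A : Type*} (ev : FreeMonoid A →* S)

/-- For a valid state, the elements before and after the transition are L-related within the R-class
of `h`, so they differ by an element of the left stabilizer. The value 1 at the sink makes outputs
from invalid states trivial. -/
theorem exists_letter (b : Q × A × Option Λ) : ∃ q : leftStab h,
    (∀ ℓ, b.2.2 = some ℓ → C.Valid (C.act (ev (.of b.2.1)) b.1) ℓ →
      C.mult (C.act (ev (.of b.2.1)) b.1) ℓ * ev (.of b.2.1) * C.rep b.1 =
        q * (C.mult b.1 (C.clsL (C.mult (C.act (ev (.of b.2.1)) b.1) ℓ * ev (.of b.2.1) *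
          C.rep b.1)) * C.rep b.1)) ∧
    (b.2.2 = none → q = 1) := by
  obtain ⟨T, a, _ | ℓ⟩ := b
  · exact ⟨1, by simp, by simp⟩
  by_cases hv : C.Valid (C.act (ev (.of a)) T) ℓ
  · obtain ⟨q, hq, hq'⟩ := exists_mul_of_greenL hv.greenR_mul hv.valid_next.greenR
      hv.greenL_next.symm
    refine ⟨⟨q, hq'⟩, ?_, by simp⟩
    rintro _ ⟨⟩ -
    exact hq
  · refine ⟨1, ?_, by simp⟩
    rintro _ ⟨⟩ hv'
    exact absurd hv' hv

/-- The element of the left stabilizer attached to a transition letter. -/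
noncomputable def letter (b : Q × A × Option Λ) : leftStab h := (C.exists_letter ev b).choose

theorem letter_spec {T : Q} {a : A} {ℓ : Λ} (hv : C.Valid (C.act (ev (.of a)) T) ℓ) :
    C.mult (C.act (ev (.of a)) T) ℓ * ev (.of a) * C.rep T =
      C.letter ev (T, a, some ℓ) * (C.mult T (C.clsL (C.mult (C.act (ev (.of a)) T) ℓ *
        ev (.of a) * C.rep T)) * C.rep T) :=
  (C.exists_letter ev (T, a, some ℓ)).choose_spec.1 ℓ rfl hv

/-- The extension of `GreenData.letter` to words. -/
noncomputable def word : FreeMonoid (Q × A × Option Λ) →* leftStab h :=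
  FreeMonoid.lift (C.letter ev)

theorem word_out_none (T : Q) (w : FreeMonoid A) :
    C.word ev ((C.transitionData ev).out T none w) = 1 := by
  induction w using FreeMonoid.inductionOn' with
  | one => simp
  | of_mul a w ih =>
    rw [TransitionData.out_of_mul, map_mul]
    refine (congrArg₂ _ ?_ ih).trans (one_mul 1)
    exact (C.exists_letter ev (_, a, none)).choose_spec.2 rfl

theorem word_out_of_not_valid {T : Q} {ℓ : Λ} {w : FreeMonoid A}
    (hv : ¬ C.Valid (C.act (ev w) T) ℓ) :
    C.word ev ((C.transitionData ev).out T (some ℓ) w) = 1 := by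
  rw [← TransitionData.out_normalize]
  have : (C.transitionData ev).next ((C.transitionData ev).act ((C.transitionData ev).ev w) T) 1
      (some ℓ) = none := C.next_of_not_valid (by rwa [C.act_one])
  rw [this, word_out_none]

/-- The contributions of the letters multiply up: the output measures the discrepancy between the
transported multiplier and the chosen one. -/
theorem mult_mul_eq_word_out {T : Q} {ℓ : Λ} {w : FreeMonoid A}
    (hv : C.Valid (C.act (ev w) T) ℓ) :
    C.mult (C.act (ev w) T) ℓ * ev w * C.rep T =
      C.word ev ((C.transitionData ev).out T (some ℓ) w) *
        (C.mult T (C.clsL (C.mult (C.act (ev w) T) ℓ * ev w * C.rep T)) * C.rep T) := by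
  induction w using FreeMonoid.inductionOn' generalizing ℓ with
  | one =>
    rw [map_one, C.act_one] at hv
    simp [C.act_one, hv.clsL_mult]
  | of_mul a w ih =>
    rw [map_mul, C.act_mul] at hv
    have hn : (C.transitionData ev).next ((C.transitionData ev).act
        ((C.transitionData ev).ev (.of a * w)) T) 1 (some ℓ) = some ℓ := by
      change C.next (C.act (ev (.of a * w)) T) 1 (some ℓ) = _
      rw [map_mul, C.act_mul, Valid.next_eq (by rwa [C.act_one]), C.act_one, mul_one,
        hv.clsL_mult]
    have hn' : (C.transitionData ev).next ((C.transitionData ev).act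
        ((C.transitionData ev).ev w) T) ((C.transitionData ev).ev (.of a)) (some ℓ) = _ :=
      hv.next_eq
    have hl := C.letter_spec ev hv
    obtain ⟨-, c, hc⟩ := C.greenR_rep_act (ev w) T
    have ih' := ih hv.valid_next
    rw [hv.clsL_mul] at ih'
    rw [TransitionData.out_of_mul, hn, hn', map_mul (C.word ev), Submonoid.coe_mul, map_mul ev,
      C.act_mul]
    have hw : ∀ b, C.word ev (.of b) = C.letter ev b := FreeMonoid.lift_eval_of _
    rw [hw, mul_assoc (C.letter ev _ : S), ← ih']
    -- Right multiplication by `c` turns the representative of the class of `ev w * rep T` into that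
    -- element.
    have hl' := congrArg (· * c) hl
    simp only [mul_assoc, ← hc] at hl' ⊢
    exact hl'

variable {G : Type*} [Monoid G] (τ : leftStab h →* G)
  (hτ : ∀ q q', τ q = τ q' ↔ (q : S) * h = q' * h)

include hτ in
-- The equation of `mult_mul_eq_word_out` involves the word only through its image in `S`, and the
-- action at one point of the R-class of `h` determines the value.
theorem val_out (T : Q) (o : Option Λ) {u v : FreeMonoid A} (huv : ev u = ev v) :
    τ (C.word ev ((C.transitionData ev).out T o u)) =
      τ (C.word ev ((C.transitionData ev).out T o v)) := by
  cases o with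
  | none => rw [word_out_none, word_out_none]
  | some ℓ =>
    by_cases hv : C.Valid (C.act (ev u) T) ℓ
    · have hu := C.mult_mul_eq_word_out ev hv
      have hv' := C.mult_mul_eq_word_out ev (huv ▸ hv)
      rw [← huv] at hv'
      exact (hτ _ _).2 (eq_of_mul_greenR hv.valid_next.greenR (hu.symm.trans hv'))
    · rw [word_out_of_not_valid _ _ hv, word_out_of_not_valid _ _ (huv ▸ hv)]

/-- The `R`-class of `h`. -/
def T₀ : Q := C.clsR h

/-- The `L`-class of the representative of the `R`-class of `h`. -/
def ℓ₀ : Λ := C.clsL (C.rep C.T₀)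

theorem greenR_rep_T₀ : GreenR (C.rep C.T₀) h := C.greenR_rep h

theorem valid_base : C.Valid C.T₀ C.ℓ₀ := ⟨1, by simpa using C.greenR_rep_T₀, by simp [ℓ₀]⟩

@[simp] theorem mult_T₀ : C.mult C.T₀ C.ℓ₀ = 1 := C.mult_base

/-- Fixing the object is the R-condition and fixing the state the L-condition. The latter may be
tested at `rep T₀`, which is only R-related to `h`. -/
theorem mem_leftStab_iff {q : S} :
    q ∈ leftStab h ↔ C.act q C.T₀ = C.T₀ ∧ C.next C.T₀ q (some C.ℓ₀) = some C.ℓ₀ := by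
  have hR : C.act q C.T₀ = C.T₀ ↔ GreenR (q * h) h := by
    rw [act]
    nth_rw 2 [T₀]
    rw [C.clsR_eq]
    exact ⟨(C.greenR_rep_T₀.symm.mul_left q).trans, (C.greenR_rep_T₀.mul_left q).trans⟩
  rw [mem_leftStab, GreenH, ← hR]
  refine and_congr_right fun ha => ?_
  have hv : C.Valid (C.act q C.T₀) C.ℓ₀ := by
    rw [ha]
    exact C.valid_base
  rw [hv.next_eq, ha, mult_T₀, one_mul, Option.some_inj]
  change GreenL (q * h) h ↔ C.clsL _ = C.clsL (C.rep C.T₀)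
  rw [C.clsL_eq]
  constructor
  · exact fun hq => GreenL.mul_left_of_greenR hq C.greenR_rep_T₀
  · exact fun hq => GreenL.mul_left_of_greenR hq C.greenR_rep_T₀.symm

include hτ in
theorem val_out_base {w : FreeMonoid A} (hw : ev w ∈ leftStab h) :
    τ (C.word ev ((C.transitionData ev).out C.T₀ (some C.ℓ₀) w)) = τ ⟨ev w, hw⟩ := by
  obtain ⟨ha, hn⟩ := C.mem_leftStab_iff.1 hw
  have hv : C.Valid (C.act (ev w) C.T₀) C.ℓ₀ := by
    rw [ha]
    exact C.valid_base
  have h₁ := C.mult_mul_eq_word_out ev hv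
  rw [hv.next_eq, Option.some_inj] at hn
  rw [hn, ha, mult_T₀, one_mul, one_mul] at h₁
  exact (hτ _ _).2 (eq_of_mul_greenR C.greenR_rep_T₀ h₁.symm)

include hτ in
-- Since q h = h s, the product x q h = x h s depends only on `τ x`; it is R-related to q h, hence a
-- right multiple of it.
theorem exists_rep (q : leftStab h) (hτs : Function.Surjective τ) (hev : Function.Surjective ev)
    (g : G) : ∃ z : FreeMonoid A, ∀ x : leftStab h, τ x = g → x * (q * h) = q * h * ev z := by
  obtain ⟨x, rfl⟩ := hτs g
  obtain ⟨s, hs⟩ := q.2.1.1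
  have hx : GreenR (x * (q * h)) (q * h) := by
    simpa only [Submonoid.coe_mul, mul_assoc] using (x * q).2.1.trans q.2.1.symm
  obtain ⟨⟨z, hz⟩, -⟩ := hx
  obtain ⟨z, rfl⟩ := hev z
  refine ⟨z, fun y hy => ?_⟩
  rw [← hz, hs, ← mul_assoc, ← mul_assoc, (hτ _ _).1 hy]

include hτ in
theorem nonempty_presenting (hτs : Function.Surjective τ) (hev : Function.Surjective ev)
    (hG : ∀ g : G, IsUnit g) : Nonempty (Presenting (C.transitionData ev) G) := by
  obtain ⟨wh, hwh⟩ := hev h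
  -- Invertibility is used here: `q` cancels the value of the output of `wh`, so that `wq * wh` has
  -- value 1.
  obtain ⟨g, hg⟩ := (hG (τ (C.word ev ((C.transitionData ev).out (C.clsR 1) (some C.ℓ₀)
    wh)))).exists_left_inv
  obtain ⟨q, rfl⟩ := hτs g
  obtain ⟨wq, hwq⟩ := hev q
  have hwq' : ev wq ∈ leftStab h := hwq ▸ q.2
  have hact : C.act h (C.clsR 1) = C.T₀ := by
    rw [act, T₀, C.clsR_eq]
    simpa using (C.greenR_rep 1).mul_left h
  choose rep hrep using exists_rep ev τ hτ q hτs hev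
  choose loop hloop using fun b => hev (C.letter ev b)
  have hloop' : ∀ b, ev (loop b) ∈ leftStab h := fun b => by rw [hloop]; exact (C.letter ev b).2
  have hword : ∀ b, C.word ev (.of b) = C.letter ev b := FreeMonoid.lift_eval_of _
  obtain ⟨ha, hn⟩ := C.mem_leftStab_iff.1 hwq'
  refine ⟨{ val := τ.comp (C.word ev)
            val_surjective := fun g => ?_
            val_out := fun T o u v huv => C.val_out ev τ hτ T o huv
            T₀ := C.T₀
            T₁ := C.clsR 1
            ℓ₀ := some C.ℓ₀
            next_one := (C.mem_leftStab_iff.1 (one_mem _)).2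
            w₀ := wq * wh
            act_w₀ := ?_
            val_w₀ := ?_
            loop := loop
            act_loop := fun b => (C.mem_leftStab_iff.1 (hloop' b)).1
            next_loop := fun b => (C.mem_leftStab_iff.1 (hloop' b)).2
            val_loop := fun b => ?_
            rep := rep
            ev_mul_w₀ := fun w ha hn => ?_ }⟩
  · obtain ⟨x, rfl⟩ := hτs g
    obtain ⟨w, hw⟩ := hev x
    refine ⟨_, (C.val_out_base ev τ hτ (w := w) (hw ▸ x.2)).trans ?_⟩
    congr 1
    exact Subtype.ext hw
  · change C.act (ev (wq * wh)) _ = _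
    rw [map_mul, C.act_mul, hwh, hact, ha]
  · rw [TransitionData.out_mul]
    have h₁ : (C.transitionData ev).act ((C.transitionData ev).ev wh) (C.clsR 1) = C.T₀ :=
      (congrArg (C.act · (C.clsR 1)) hwh).trans hact
    have h₂ : (C.transitionData ev).next C.T₀ ((C.transitionData ev).ev wq) (some C.ℓ₀) =
      some C.ℓ₀ := hn
    rw [h₁, h₂, map_mul, ← hg]
    congr 1
    refine (C.val_out_base ev τ hτ hwq').trans ?_
    congr 1
    exact Subtype.ext hwq
  · refine (C.val_out_base ev τ hτ (hloop' b)).trans ?_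
    rw [MonoidHom.comp_apply, hword]
    congr 1
    exact Subtype.ext (hloop b)
  · have hw : ev w ∈ leftStab h := C.mem_leftStab_iff.2 ⟨ha, hn⟩
    have h₁ := hrep _ _ (C.val_out_base ev τ hτ hw).symm
    change ev (w * (wq * wh)) = ev ((wq * wh) * _)
    simp only [map_mul, hwq, hwh]
    exact h₁

end GreenData

/-! ### Choice of the data and conclusion -/

open Squier in
theorem corollary2p2 {S : Type*} [Monoid S]
    (hleft : Finite (SubMulAction S S)) (hright : Finite (SubMulAction Sᵐᵒᵖ S))
    (hS : MonoidFDT S) (H : Set S) (hH : IsHClass H) :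
    MonoidFDT (SchutzenbergerGroup H) := by
  have hG := SchutzenbergerGroup.isUnit hH
  obtain ⟨h, rfl⟩ := hH
  obtain ⟨A, R, hA, hR, ⟨e⟩, hfdt⟩ := hS
  obtain ⟨n, clsR, hsurj, hclsR⟩ := exists_fin_greenR S
  obtain ⟨m, clsL, hclsL⟩ := exists_fin_greenL S
  choose rep hrep using hsurj
  -- At the base pair the multiplier is forced to be 1, which is admissible because that
  -- representative is R-related to `h`; at unreachable pairs 1 is only a default.
  have hmult : ∀ T ℓ, ∃ p : S, ((∃ p, GreenR (p * rep T) h ∧ clsL (p * rep T) = ℓ) →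
      GreenR (p * rep T) h ∧ clsL (p * rep T) = ℓ) ∧
      (T = clsR h ∧ ℓ = clsL (rep (clsR h)) → p = 1) := by
    intro T ℓ
    by_cases h₀ : T = clsR h ∧ ℓ = clsL (rep (clsR h))
    · obtain ⟨rfl, rfl⟩ := h₀
      refine ⟨1, fun _ => ?_, fun _ => rfl⟩
      rw [one_mul, ← hclsR, hrep]
      exact ⟨rfl, rfl⟩
    · by_cases h₁ : ∃ p, GreenR (p * rep T) h ∧ clsL (p * rep T) = ℓ
      · obtain ⟨p, hp⟩ := h₁
        exact ⟨p, fun _ => hp, fun h => absurd h h₀⟩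
      · exact ⟨1, fun h => absurd h h₁, fun _ => rfl⟩
  choose mult hmult₁ hmult₂ using hmult
  let C : GreenData h (Fin n) (Fin m) :=
    ⟨clsR, hclsR, rep, hrep, clsL, hclsL, mult, hmult₁, hmult₂ _ _ ⟨rfl, rfl⟩⟩
  obtain ⟨τ, hτs, hτ⟩ := exists_leftStab_hom h
  let ev : FreeMonoid A →* S := e.toMonoidHom.comp (PresentedMonoid.mk _)
  obtain ⟨P⟩ := C.nonempty_presenting ev τ hτ hτs
    (e.surjective.comp PresentedMonoid.surjective_mk) hG
  exact P.monoidFDT hR (fun r hr => congrArg e (PresentedMonoid.mk_eq_mk_of_rel hr))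
    (fun u v huv => e.injective huv) hfdt
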